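/- Let $n\in\mathbb{N}$. For $U\subseteq\mathbb{R}^n$ open let $\mathcal{C}^0(U)$ be the real vector space of continuous functions $U\to\mathbb{R}$, so that $\mathcal{C}^0$ is a sheaf of real vector spaces on $\mathbb{R}^n$. For $k=1,\dots,n$ let $\mathcal{C}^1_k(U)$ be the set of all $f\in\mathcal{C}^0(U)$ such that, for every $x\in U$, the function $t\mapsto f(x_1,\dots,x_{k-1},t,x_{k+1},\dots,x_n)$ is of class $\mathcal{C}^1$ on the open set of all $t\in\mathbb{R}$ for which $(x_1,\dots,x_{k-1},t,x_{k+1},\dots,x_n)\in U$, and such that $\partial_k f\in\mathcal{C}^0(U)$. An $n$-dimensional interval is a set $(c_1-r,c_1+r)\times\dots\times(c_n-r,c_n+r)$ with $c\in\mathbb{R}^n$ and $r>0$. For $\alpha\in\mathbb{N}^n$ let $\mathcal{P}_\alpha(U)$ be the set of all functions $\theta_1+\dots+\theta_n$, where each $\theta_k:U\to\mathbb{R}$ is a polynomial in $x_k$ of degree $<\alpha_k$ whose coefficients are continuous functions on $U$ that do not depend on $x_k$ (so $\theta_k=0$ if $\alpha_k=0$). Consider triples $(H,j,(\delta_k)_{k=1,\dots,n})$,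 where $H$ is a sheaf of real vector spaces on $\mathbb{R}^n$, and $j:\mathcal{C}^0\to H$ and $\delta_k:H\to H$ are morphisms of sheaves of real vector spaces; put $\delta_U^\alpha:=\delta_{1U}^{\alpha_1}\circ\dots\circ\delta_{nU}^{\alpha_n}$ for $\alpha\in\mathbb{N}^n$. Such a triple is called a solution if 1. $\delta_{kU}(j_U(f))=j_U(\partial_k f)$ for all $k$, all open $U\subseteq\mathbb{R}^n$ and all $f\in\mathcal{C}^1_k(U)$; 2. $\delta_U^\alpha(j_U(f))=0$ for all $\alpha\in\mathbb{N}^n$, all $n$-dimensional intervals $U$ and all $f\in\mathcal{P}_\alpha(U)$; 3. $\delta_h\circ\delta_k=\delta_k\circ\delta_h$ for all $h,k$. A solution $(H,j,(\delta_k)_k)$ is called co-universal if for every solution $(\overline{H},\overline{\jmath},(\overline{\delta}_k)_k)$ there is exactly one sheaf morphism $\psi:H\to\overline{H}$ such that $\psi\circ j=\overline{\jmath}$ and $\psi\circ\delta_k=\overline{\delta}_k\circ\psi$ for all $k$. **Corollary.** Let $(H,j,(\delta_k)_k)$ be a co-universal solution. Then: (i) (local structure) If $U\subseteq\mathbb{R}^n$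 is open and $C$ is an open set whose closure is compact and contained in $U$, then for every $w\in H(U)$ there are $\alpha\in\mathbb{N}^n$ and $f\in\mathcal{C}^0(C)$ such that $w|_C=\delta_C^\alpha(j_C(f))$. (ii) (necessary polynomial condition) If $\alpha\in\mathbb{N}^n$, $U$ is an $n$-dimensional interval, $f,g\in\mathcal{C}^0(U)$ and $\delta_U^\alpha(j_U(f))=\delta_U^\alpha(j_U(g))$, then $f-g\in\mathcal{P}_\alpha(U)$. -/

import Mathlib

open CategoryTheory TopologicalSpace Opposite

universe u

namespace DistrUP

/-- The topological space `ℝⁿ` (only its topology matters below). -/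
abbrev Rn (n : ℕ) : TopCat.{0} := TopCat.of (Fin n → ℝ)

variable {n : ℕ}

/-- Sheaves of real vector spaces on `ℝⁿ`. -/
abbrev VectSheaf (n : ℕ) := TopCat.Sheaf (ModuleCat.{u} ℝ) (Rn n)

/-- The vector space `H(U)` of sections of `H` over `U`. -/
abbrev Sec (H : VectSheaf.{u} n) (U : Opens (Rn n)) : Type u := H.presheaf.obj (op U)

/-- The restriction `H(U) → H(V)`, for `V ⊆ U`. -/
def secRes (H : VectSheaf.{u} n) {U V : Opens (Rn n)} (hVU : V ≤ U) : Sec H U →ₗ[ℝ] Sec H V :=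
  (H.presheaf.map (homOfLE hVU).op).hom

/-- The component `H(U) → H'(U)` of a morphism of sheaves. -/
def secMap {H H' : VectSheaf.{u} n} (ψ : H ⟶ H') (U : Opens (Rn n)) : Sec H U →ₗ[ℝ] Sec H' U :=
  (ψ.hom.app (op U)).hom

/-- The restriction `C⁰(U) → C⁰(V)`, for `V ⊆ U`. -/
def resC0 {U V : Opens (Rn n)} (hVU : V ≤ U) (f : C(U, ℝ)) : C(V, ℝ) :=
  f.comp ⟨Set.inclusion hVU, continuous_inclusion hVU⟩

/-- Morphisms of sheaves of real vector spaces `C⁰ → H`, where `C⁰` is the sheaf of continuous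
real functions on `ℝⁿ`: linear maps `C⁰(U) → H(U)` that commute with restrictions. -/
structure C0Hom (H : VectSheaf.{u} n) where
  app : ∀ U : Opens (Rn n), C(U, ℝ) →ₗ[ℝ] Sec H U
  naturality : ∀ (U V : Opens (Rn n)) (hVU : V ≤ U) (f : C(U, ℝ)),
    app V (resC0 hVU f) = secRes H hVU (app U f)

/-- The set `U_k(x)` of the `t` such that `x`, with its `k`-th coordinate replaced by `t`, is
in `U`. -/
def sliceDom (U : Opens (Rn n)) (k : Fin n) (x : Fin n → ℝ) : Set ℝ :=
  {t | Function.update x k t ∈ (U : Set (Fin n → ℝ))}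

open Classical in
/-- The function `t ↦ f (x₁, …, t, …, xₙ)`, with `t` in the place of `x_k`, on `U_k(x)`; its
value outside of the open set `U_k(x)` is irrelevant. -/
noncomputable def slice {U : Opens (Rn n)} (k : Fin n) (f : U → ℝ) (x : Fin n → ℝ) : ℝ → ℝ :=
  fun t => if h : Function.update x k t ∈ (U : Set (Fin n → ℝ)) then
    f ⟨Function.update x k t, h⟩ else 0

/-- The partial derivative `∂_k f` of a function `f` on `U`. -/
noncomputable def partialDeriv {U : Opens (Rn n)} (k : Fin n) (f : U → ℝ) : U → ℝ :=
  fun x => deriv (slice k f x.1) (x.1 k)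

/-- `f` is of class `C¹_k` on `U`: every slice of `f` in the `k`-th variable is of class `C¹`,
and `∂_k f` is continuous on `U`. -/
structure IsC1 {U : Opens (Rn n)} (k : Fin n) (f : C(U, ℝ)) : Prop where
  contDiffOn_slice : ∀ x : U, ContDiffOn ℝ 1 (slice k f x.1) (sliceDom U k x.1)
  continuous_partialDeriv : Continuous (partialDeriv k f)

/-- `U = (c₁ - r, c₁ + r) × ⋯ × (cₙ - r, cₙ + r)` for some `c ∈ ℝⁿ` and `r > 0`. -/
def IsInterval (U : Opens (Rn n)) : Prop :=
  ∃ (c : Fin n → ℝ) (r : ℝ), 0 < r ∧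
    (U : Set (Fin n → ℝ)) = Set.univ.pi fun i => Set.Ioo (c i - r) (c i + r)

/-- `θ` is a polynomial in `x_k` of degree `< d` whose coefficients are continuous functions
on `U` that do not depend on `x_k`. -/
def IsPolyIn {U : Opens (Rn n)} (k : Fin n) (d : ℕ) (θ : C(U, ℝ)) : Prop :=
  ∃ c : Fin d → C(U, ℝ),
    (∀ m, ∀ x y : U, (∀ i, i ≠ k → x.1 i = y.1 i) → c m x = c m y) ∧
    ∀ x : U, θ x = ∑ m : Fin d, c m x * x.1 k ^ (m : ℕ)

/-- `f = θ₁ + ⋯ + θₙ`, where each `θ_k` is a polynomial in `x_k` of degree `< α_k` whose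
coefficients are continuous functions on `U` that do not depend on `x_k`. -/
def IsPolySum {U : Opens (Rn n)} (α : Fin n → ℕ) (f : C(U, ℝ)) : Prop :=
  ∃ θ : Fin n → C(U, ℝ), (∀ k, IsPolyIn k (α k) (θ k)) ∧ f = ∑ k, θ k

/-- `δ^α = δ₁^α₁ ∘ ⋯ ∘ δₙ^αₙ` on `H(U)`. -/
def iterD {H : VectSheaf.{u} n} (δ : Fin n → (H ⟶ H)) (α : Fin n → ℕ) (U : Opens (Rn n)) :
    Module.End ℝ (Sec H U) :=
  (List.ofFn fun k => (secMap (δ k) U : Module.End ℝ (Sec H U)) ^ α k).prod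

/-- The problem `P(H, j, (δ_k)_k)`: `H` is a sheaf of real vector spaces on `ℝⁿ`, and `j` and
the `δ_k` are sheaf morphisms, with the following properties. -/
structure IsSolution (H : VectSheaf.{u} n) (j : C0Hom H) (δ : Fin n → (H ⟶ H)) : Prop where
  /-- `δ_k ∘ j` is `j ∘ ∂_k` on functions of class `C¹_k`. -/
  compat : ∀ (k : Fin n) (U : Opens (Rn n)) (f : C(U, ℝ)) (hf : IsC1 k f),
    secMap (δ k) U (j.app U f) = j.app U ⟨partialDeriv k f, hf.continuous_partialDeriv⟩
  poly : ∀ (α : Fin n → ℕ) (U : Opens (Rn n)) (f : C(U, ℝ)), IsInterval U → IsPolySum α f →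
    iterD δ α U (j.app U f) = 0
  comm : ∀ h k : Fin n, δ h ≫ δ k = δ k ≫ δ h

/-- The property `Q`: `ψ` preserves embeddings and derivatives. -/
structure Preserves {H H' : VectSheaf.{u} n} (j : C0Hom H) (δ : Fin n → (H ⟶ H))
    (j' : C0Hom H') (δ' : Fin n → (H' ⟶ H')) (ψ : H ⟶ H') : Prop where
  embed : ∀ (U : Opens (Rn n)) (f : C(U, ℝ)), secMap ψ U (j.app U f) = j'.app U f
  deriv : ∀ k : Fin n, δ k ≫ ψ = ψ ≫ δ' k

/-- `(H, j, (δ_k)_k)` is a co-universal solution of the problem `P` with respect to `Q`. -/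
def IsCoUniversalSolution (H : VectSheaf.{u} n) (j : C0Hom H) (δ : Fin n → (H ⟶ H)) : Prop :=
  IsSolution H j δ ∧
    ∀ (H' : VectSheaf.{u} n) (j' : C0Hom H') (δ' : Fin n → (H' ⟶ H')),
      IsSolution H' j' δ' → ∃! ψ : H ⟶ H', Preserves j δ j' δ' ψ

end DistrUP

/-! Write `I_k` for an antiderivative in `x_k` and `P_α` for the sums of polynomials of the
statement. Both halves test `H` against a suitable solution.

For (ii), one solution in which `δ^α (j f) = 0` forces `f ∈ P_α` on intervals is enough, since the
morphism from `H` carries the equation there. In the model, the stalk at `x` consists of formal sums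
`∑ δ^α f_α`, modulo those for which `∑ I^(γ-α) f_α` lies in `P_γ` near `x` for all large `γ`;
sections are arbitrary families of stalk elements. The crux is that `I_k f ∈ P_(γ+e_k)` near `x`
implies `f ∈ P_γ` near `x` (`mem_polySumOn_of_antideriv`). The summands of `I_k f` need not be
differentiable in `x_k`, so the decomposition cannot be differentiated. Instead, successive Lagrange
interpolation turns membership in `P_γ` into the vanishing of finite linear combinations of values
(`mem_polySumOn_iff`), a condition that survives pointwise limits of difference quotients. The same
criterion lets membership pass from small sets to intervals (`isPolySum_of_local`).

For (i), the sections that are locally of the form `δ^α F` form a subsheaf that is again a solution.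
The morphism from `H` to it, followed by the inclusion, is the identity by uniqueness, so every
section is local in this sense. Gluing near a compact set needs cutoffs although `H` has no
multiplication by functions: `cutoff` is an operator `T` on continuous functions with, formally,
`∂^a (T f) = χ ∂^a f`. Modulo `P_α`, the product of these operators is the identity where all `χ_k`
are `1`, and zero where some `χ_k` is `0`. By (ii), two local representatives `F`, `G` of the same
order `α` differ by an element of `P_α`, so `G + T (F - G)` represents the section wherever `F` or
`G` has to (`exists_locEq_finset`). -/

namespace DistrUP

/-! ### Operators on continuous functions and spaces of polynomials -/

section Operators

variable {n : ℕ}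

/-- Continuous functions on the whole of `ℝⁿ`. -/
abbrev CFun (n : ℕ) := C(Fin n → ℝ, ℝ)

/-- The `k`-th coordinate function. -/
def coord (k : Fin n) : CFun n := ⟨fun x => x k, continuous_apply k⟩

@[simp] theorem coord_apply (k : Fin n) (x : Fin n → ℝ) : coord k x = x k := rfl

/-- `f` does not depend on the `k`-th variable. -/
def IndepOf (k : Fin n) (f : (Fin n → ℝ) → ℝ) : Prop :=
  ∀ x t, f (Function.update x k t) = f x

/-- Evaluation of the `k`-th variable at `s`. -/
def evalAt (k : Fin n) (s : ℝ) : Module.End ℝ (CFun n) where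
  toFun f := ⟨fun x => f (Function.update x k s),
    f.continuous.comp (continuous_id.update k continuous_const)⟩
  map_add' _ _ := rfl
  map_smul' _ _ := rfl

@[simp] theorem evalAt_apply (k : Fin n) (s : ℝ) (f : CFun n) (x : Fin n → ℝ) :
    evalAt k s f x = f (Function.update x k s) := rfl

/-- Translation of the `k`-th variable by `h`. -/
def transl (k : Fin n) (h : ℝ) : Module.End ℝ (CFun n) where
  toFun f := ⟨fun x => f (Function.update x k (x k + h)),
    f.continuous.comp (continuous_id.update k ((continuous_apply k).add continuous_const))⟩
  map_add' _ _ := rfl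
  map_smul' _ _ := rfl

@[simp] theorem transl_apply (k : Fin n) (h : ℝ) (f : CFun n) (x : Fin n → ℝ) :
    transl k h f x = f (Function.update x k (x k + h)) := rfl

/-- Multiplication by a function of the `k`-th variable. -/
def mulCoord (k : Fin n) (χ : C(ℝ, ℝ)) : Module.End ℝ (CFun n) where
  toFun f := χ.comp (coord k) * f
  map_add' _ _ := mul_add _ _ _
  map_smul' _ _ := mul_smul_comm _ _ _

@[simp] theorem mulCoord_apply (k : Fin n) (χ : C(ℝ, ℝ)) (f : CFun n) (x : Fin n → ℝ) :
    mulCoord k χ f x = χ (x k) * f x := rfl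

theorem continuous_slice (f : CFun n) (k : Fin n) (x : Fin n → ℝ) :
    Continuous fun t => f (Function.update x k t) :=
  f.continuous.comp (continuous_const.update k continuous_id)

theorem continuous_antideriv (f : CFun n) (k : Fin n) (c : ℝ) :
    Continuous fun x : Fin n → ℝ => ∫ t in c..x k, f (Function.update x k t) := by
  have h : Continuous (Function.uncurry fun (x : Fin n → ℝ) (t : ℝ) => f (Function.update x k t)) :=
    f.continuous.comp (continuous_fst.update k continuous_snd)
  exact intervalIntegral.continuous_parametric_intervalIntegral_of_continuous h
    (continuous_apply k)

/-- The antiderivative in the `k`-th variable that vanishes at `c k`. -/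
noncomputable def antideriv (c : Fin n → ℝ) (k : Fin n) : Module.End ℝ (CFun n) where
  toFun f := ⟨fun x => ∫ t in c k..x k, f (Function.update x k t), continuous_antideriv f k (c k)⟩
  map_add' f g := by
    ext x
    exact intervalIntegral.integral_add ((continuous_slice f k x).intervalIntegrable _ _)
      ((continuous_slice g k x).intervalIntegrable _ _)
  map_smul' r f := by
    ext x
    exact intervalIntegral.integral_smul r _

theorem antideriv_apply (c : Fin n → ℝ) (k : Fin n) (f : CFun n) (x : Fin n → ℝ) :
    antideriv c k f x = ∫ t in c k..x k, f (Function.update x k t) := rfl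

theorem antideriv_update (c : Fin n → ℝ) (k : Fin n) (f : CFun n) (x : Fin n → ℝ) (s : ℝ) :
    antideriv c k f (Function.update x k s) = ∫ t in c k..s, f (Function.update x k t) := by
  simp [antideriv_apply]

theorem hasDerivAt_antideriv (c : Fin n → ℝ) (k : Fin n) (f : CFun n) (x : Fin n → ℝ) (s : ℝ) :
    HasDerivAt (fun t => antideriv c k f (Function.update x k t)) (f (Function.update x k s)) s := by
  simp only [antideriv_update]
  exact intervalIntegral.integral_hasDerivAt_right
    ((continuous_slice f k x).intervalIntegrable _ _)
    ((continuous_slice f k x).stronglyMeasurableAtFilter _ _) (continuous_slice f k x).continuousAt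

/-- A function whose slices are differentiable is determined by its derivative and its values
at the base point. -/
theorem eq_antideriv_of_hasDerivAt (c : Fin n → ℝ) (k : Fin n) (f g : CFun n)
    (h : ∀ x s, HasDerivAt (fun t => f (Function.update x k t)) (g (Function.update x k s)) s) :
    f = evalAt k (c k) f + antideriv c k g := by
  ext x
  have := intervalIntegral.integral_eq_sub_of_hasDerivAt (a := c k) (b := x k)
    (fun t _ => h x t) ((continuous_slice g k x).intervalIntegrable _ _)
  simp [antideriv_apply, this]

/-- Fubini on a compact rectangle when `i ≠ k`. -/
theorem antideriv_comm (c : Fin n → ℝ) (i k : Fin n) :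
    Commute (antideriv c i) (antideriv c k) := by
  rcases eq_or_ne i k with rfl | hik
  · exact Commute.refl _
  refine LinearMap.ext fun f => ContinuousMap.ext fun x => ?_
  simp only [Module.End.mul_apply, antideriv_apply, Function.update_of_ne hik,
    Function.update_of_ne hik.symm]
  rw [MeasureTheory.intervalIntegral_intervalIntegral_swap]
  · simp only [Function.update_comm hik]
  · have : Continuous (Function.uncurry fun (s t : ℝ) =>
        f (Function.update (Function.update x i s) k t)) := by
      have h : Continuous fun p : ℝ × ℝ => Function.update x i p.1 :=
        continuous_const.update i continuous_fst
      exact f.continuous.comp (h.update k continuous_snd)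
    exact (this.continuousOn.integrableOn_compact (isCompact_uIcc.prod isCompact_uIcc)).mono_set
      (Set.prod_mono Set.uIoc_subset_uIcc Set.uIoc_subset_uIcc)

theorem IndepOf.antideriv {c : Fin n → ℝ} {i k : Fin n} (hik : i ≠ k) {f : CFun n}
    (hf : IndepOf i f) : IndepOf i (antideriv c k f) := by
  intro x t
  simp only [antideriv_apply, Function.update_of_ne hik.symm]
  congr 1; ext s
  rw [Function.update_comm hik, hf]

theorem indepOf_evalAt (k : Fin n) (s : ℝ) (f : CFun n) : IndepOf k (evalAt k s f) := by
  intro x t; simp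

theorem IndepOf.mulCoord {i k : Fin n} (hik : i ≠ k) {f : CFun n}
    (hf : IndepOf i f) (χ : C(ℝ, ℝ)) : IndepOf i (mulCoord k χ f) := by
  intro x t
  simp [Function.update_of_ne hik.symm, hf x t]

theorem IndepOf.transl {i k : Fin n} (hik : i ≠ k) {f : CFun n}
    (hf : IndepOf i f) (h : ℝ) : IndepOf i (transl k h f) := by
  intro x t
  simp only [transl_apply, Function.update_of_ne hik.symm]
  rw [Function.update_comm hik, hf]

/-- Polynomials in `x_k` of degree less than `a` with continuous coefficients that do not depend
on `x_k`. -/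
def polyIn (k : Fin n) (a : ℕ) : Submodule ℝ (CFun n) :=
  Submodule.span ℝ {p | ∃ m < a, ∃ g : CFun n, IndepOf k g ∧ p = g * coord k ^ m}

theorem mul_coord_pow_mem_polyIn {k : Fin n} {a m : ℕ} (hm : m < a) {g : CFun n}
    (hg : IndepOf k g) : g * coord k ^ m ∈ polyIn k a :=
  Submodule.subset_span ⟨m, hm, g, hg, rfl⟩

theorem IndepOf.mem_polyIn {k : Fin n} {a : ℕ} (ha : 0 < a) {g : CFun n}
    (hg : IndepOf k g) : g ∈ polyIn k a := by
  simpa using mul_coord_pow_mem_polyIn ha hg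

theorem polyIn_mono (k : Fin n) {a b : ℕ} (hab : a ≤ b) : polyIn k a ≤ polyIn k b := by
  refine Submodule.span_le.2 ?_
  rintro _ ⟨m, hm, g, hg, rfl⟩
  exact mul_coord_pow_mem_polyIn (hm.trans_le hab) hg

@[simp] theorem polyIn_zero (k : Fin n) : polyIn k 0 = ⊥ := by
  simp [polyIn]

/-- To map `polyIn k a` into a submodule it is enough to treat monomials. -/
theorem map_mem_of_mem_polyIn {k : Fin n} {a : ℕ} (φ : Module.End ℝ (CFun n))
    (S : Submodule ℝ (CFun n))
    (h : ∀ m < a, ∀ g : CFun n, IndepOf k g → φ (g * coord k ^ m) ∈ S) {p : CFun n}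
    (hp : p ∈ polyIn k a) : φ p ∈ S := by
  have : polyIn k a ≤ S.comap φ := by
    refine Submodule.span_le.2 ?_
    rintro _ ⟨m, hm, g, hg, rfl⟩
    exact h m hm g hg
  exact this hp

theorem antideriv_mul_coord_pow (c : Fin n → ℝ) (k : Fin n) {g : CFun n} (hg : IndepOf k g)
    (m : ℕ) : (m + 1 : ℝ) • antideriv c k (g * coord k ^ m)
      = g * coord k ^ (m + 1) - c k ^ (m + 1) • g := by
  have := eq_antideriv_of_hasDerivAt c k (g * coord k ^ (m + 1))
    ((m + 1 : ℝ) • (g * coord k ^ m)) (fun x s => by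
      have h := ((hasDerivAt_pow (m + 1) s).const_mul (g x))
      simp only [ContinuousMap.coe_mul, ContinuousMap.coe_pow, Pi.mul_apply, Pi.pow_apply, hg x,
        coord_apply, Function.update_self, ContinuousMap.coe_smul, Pi.smul_apply, smul_eq_mul]
      refine h.congr_deriv ?_
      simp only [Nat.add_sub_cancel]
      push_cast
      ring)
  rw [map_smul] at this
  rw [eq_sub_iff_add_eq, this, add_comm]
  congr 1
  · ext x; simp [hg x, mul_comm]

theorem antideriv_mem_polyIn (c : Fin n → ℝ) (k : Fin n) {a : ℕ} {p : CFun n}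
    (hp : p ∈ polyIn k a) : antideriv c k p ∈ polyIn k (a + 1) := by
  refine map_mem_of_mem_polyIn _ _ (fun m hm g hg => ?_) hp
  have h := antideriv_mul_coord_pow c k hg m
  have hm0 : (m + 1 : ℝ) ≠ 0 := by positivity
  rw [← inv_smul_smul₀ hm0 (antideriv c k _), h]
  exact Submodule.smul_mem _ _ (Submodule.sub_mem _ (mul_coord_pow_mem_polyIn (by lia) hg)
    (Submodule.smul_mem _ _ (hg.mem_polyIn (by lia))))

theorem antideriv_mem_polyIn_of_ne (c : Fin n → ℝ) {i k : Fin n} (hik : i ≠ k) {a : ℕ}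
    {p : CFun n} (hp : p ∈ polyIn i a) : antideriv c k p ∈ polyIn i a := by
  refine map_mem_of_mem_polyIn _ _ (fun m hm g hg => ?_) hp
  convert mul_coord_pow_mem_polyIn hm (hg.antideriv (c := c) hik) using 1
  ext x
  simp [antideriv_apply, Function.update_of_ne hik]

theorem mulCoord_mem_polyIn_of_ne {i k : Fin n} (hik : i ≠ k) {a : ℕ} (χ : C(ℝ, ℝ))
    {p : CFun n} (hp : p ∈ polyIn i a) : mulCoord k χ p ∈ polyIn i a := by
  refine map_mem_of_mem_polyIn _ _ (fun m hm g hg => ?_) hp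
  convert mul_coord_pow_mem_polyIn hm (hg.mulCoord hik χ) using 1
  ext x
  simp [mul_assoc]

theorem transl_mem_polyIn_of_ne {i k : Fin n} (hik : i ≠ k) {a : ℕ} (h : ℝ)
    {p : CFun n} (hp : p ∈ polyIn i a) : transl k h p ∈ polyIn i a := by
  refine map_mem_of_mem_polyIn _ _ (fun m hm g hg => ?_) hp
  convert mul_coord_pow_mem_polyIn hm (hg.transl hik h) using 1
  ext x
  simp [Function.update_of_ne hik]

/-- The leading terms cancel in the binomial expansion. Differences stand in for derivatives, as
they make sense for summands that are only continuous. -/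
theorem transl_sub_mem_polyIn (k : Fin n) {a : ℕ} (h : ℝ)
    {p : CFun n} (hp : p ∈ polyIn k (a + 1)) : transl k h p - p ∈ polyIn k a := by
  refine map_mem_of_mem_polyIn (transl k h - 1) _ (fun m hm g hg => ?_) hp
  have : (transl k h - 1 : Module.End ℝ (CFun n)) (g * coord k ^ m) =
      ∑ i ∈ Finset.range m, (h ^ (m - i) * m.choose i) • (g * coord k ^ i) := by
    ext x
    simp only [LinearMap.sub_apply, transl_apply, Module.End.one_apply, ContinuousMap.coe_sub,
      Pi.sub_apply, ContinuousMap.coe_mul, Pi.mul_apply, ContinuousMap.coe_pow, Pi.pow_apply,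
      coord_apply, Function.update_self, hg x, ContinuousMap.coe_sum, Finset.sum_apply,
      ContinuousMap.coe_smul, Pi.smul_apply, smul_eq_mul, add_pow, Finset.sum_range_succ]
    simp only [Nat.sub_self, pow_zero, Nat.choose_self, mul_add, Finset.mul_sum]
    simp only [Nat.cast_one, mul_one, add_sub_cancel_right]
    exact Finset.sum_congr rfl fun i _ => by ring
  rw [this]
  exact Submodule.sum_mem _ fun i hi => Submodule.smul_mem _ _
    (mul_coord_pow_mem_polyIn (by have := Finset.mem_range.1 hi; lia) hg)

/-- A polynomial of degree at most `a` is the sum of its value at the base point and of an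
antiderivative of a polynomial of degree less than `a`. -/
theorem exists_eq_add_antideriv (c : Fin n → ℝ) (k : Fin n) {a : ℕ} {p : CFun n}
    (hp : p ∈ polyIn k (a + 1)) :
    ∃ g q : CFun n, IndepOf k g ∧ q ∈ polyIn k a ∧ p = g + antideriv c k q := by
  refine Submodule.span_induction (p := fun p _ => ∃ g q : CFun n, IndepOf k g ∧ q ∈ polyIn k a ∧
    p = g + antideriv c k q) ?_ ?_ ?_ ?_ hp
  · rintro _ ⟨m, hm, g, hg, rfl⟩
    rcases m with _ | m
    · exact ⟨g, 0, hg, zero_mem _, by simp⟩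
    · refine ⟨c k ^ (m + 1) • g, (m + 1 : ℝ) • (g * coord k ^ m), fun x t => ?_,
        Submodule.smul_mem _ _ (mul_coord_pow_mem_polyIn (by lia) hg), ?_⟩
      · simp [hg x t]
      · rw [map_smul, antideriv_mul_coord_pow c k hg]; abel
  · exact ⟨0, 0, fun _ _ => rfl, zero_mem _, by simp⟩
  · rintro _ _ _ _ ⟨g, q, hg, hq, rfl⟩ ⟨g', q', hg', hq', rfl⟩
    exact ⟨g + g', q + q', fun x t => by simp [hg x t, hg' x t], add_mem hq hq', by
      rw [map_add]; abel⟩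
  · rintro r _ _ ⟨g, q, hg, hq, rfl⟩
    exact ⟨r • g, r • q, fun x t => by simp [hg x t], Submodule.smul_mem _ _ hq, by
      rw [map_smul, smul_add]⟩

/-- The functions that vanish on `B`. -/
def zeroOn (B : Set (Fin n → ℝ)) : Submodule ℝ (CFun n) where
  carrier := {f | ∀ x ∈ B, f x = 0}
  add_mem' hf hg x hx := by simp [hf x hx, hg x hx]
  zero_mem' _ _ := rfl
  smul_mem' r f hf x hx := by simp [hf x hx]

/-- The functions that are equal on `B` to a sum of polynomials in `x_k` of degree less
than `α k`. -/
def polySumOn (α : Fin n → ℕ) (B : Set (Fin n → ℝ)) : Submodule ℝ (CFun n) :=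
  (⨆ k, polyIn k (α k)) ⊔ zeroOn B

theorem polyIn_le_polySumOn (α : Fin n → ℕ) (B : Set (Fin n → ℝ)) (k : Fin n) :
    polyIn k (α k) ≤ polySumOn α B :=
  (le_iSup (fun k => polyIn k (α k)) k).trans le_sup_left

theorem zeroOn_le_polySumOn (α : Fin n → ℕ) (B : Set (Fin n → ℝ)) :
    zeroOn B ≤ polySumOn α B := le_sup_right

theorem polySumOn_mono {α β : Fin n → ℕ} (hαβ : α ≤ β) {B B' : Set (Fin n → ℝ)} (hB : B' ⊆ B) :
    polySumOn α B ≤ polySumOn β B' :=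
  sup_le_sup (iSup_mono fun k => polyIn_mono k (hαβ k)) fun _ hf x hx => hf x (hB hx)

theorem map_mem_of_mem_polySumOn {α : Fin n → ℕ} {B : Set (Fin n → ℝ)} (φ : Module.End ℝ (CFun n))
    (S : Submodule ℝ (CFun n)) (h : ∀ k, ∀ p ∈ polyIn k (α k), φ p ∈ S)
    (h0 : ∀ p ∈ zeroOn B, φ p ∈ S) {f : CFun n} (hf : f ∈ polySumOn α B) : φ f ∈ S := by
  have : polySumOn α B ≤ S.comap φ := sup_le (iSup_le fun k p hp => h k p hp) fun p hp => h0 p hp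
  exact this hf

end Operators

/-! ### Successive Lagrange interpolation as a test for sums of polynomials -/

section Interpolation

variable {n : ℕ}

/-- Lagrange interpolation in the `k`-th variable with nodes `t`. -/
noncomputable def interp (k : Fin n) {a : ℕ} (t : Fin a → ℝ) :
    Module.End ℝ ((Fin n → ℝ) → ℝ) where
  toFun f x := ∑ m, (Lagrange.basis Finset.univ t m).eval (x k) * f (Function.update x k (t m))
  map_add' f g := by
    ext x; simp [mul_add, Finset.sum_add_distrib]
  map_smul' r f := by
    ext x
    simp only [Pi.smul_apply, smul_eq_mul, RingHom.id_apply, Finset.mul_sum]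
    exact Finset.sum_congr rfl fun i _ => by ring

theorem interp_apply (k : Fin n) {a : ℕ} (t : Fin a → ℝ) (f : (Fin n → ℝ) → ℝ) (x : Fin n → ℝ) :
    interp k t f x = ∑ m, (Lagrange.basis Finset.univ t m).eval (x k) *
      f (Function.update x k (t m)) := rfl

variable {α : Fin n → ℕ} (t : ∀ k, Fin (α k) → ℝ)

/-- The remainder of successive interpolations in the variables of a list. -/
noncomputable def interpRem : List (Fin n) → Module.End ℝ ((Fin n → ℝ) → ℝ)
  | [] => 1
  | k :: l => interpRem l - interp k (t k) * interpRem l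

theorem interpRem_cons (k : Fin n) (l : List (Fin n)) (f : (Fin n → ℝ) → ℝ) :
    interpRem t (k :: l) f = interpRem t l f - interp k (t k) (interpRem t l f) := rfl

/-- `B` contains with a point all the points obtained by replacing a coordinate by a node. -/
def NodeClosed (B : Set (Fin n → ℝ)) : Prop :=
  ∀ x ∈ B, ∀ k m, Function.update x k (t k m) ∈ B

variable {t}

theorem interpRem_congr {B : Set (Fin n → ℝ)} (hB : NodeClosed t B) (l : List (Fin n))
    {f g : (Fin n → ℝ) → ℝ} (hfg : ∀ x ∈ B, f x = g x) :
    ∀ x ∈ B, interpRem t l f x = interpRem t l g x := by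
  induction l with
  | nil => exact hfg
  | cons k l ih =>
    intro x hx
    simp only [interpRem_cons, Pi.sub_apply, interp_apply, ih x hx]
    congr 1
    exact Finset.sum_congr rfl fun m _ => by rw [ih _ (hB x hx k m)]

/-- At a fixed point the remainder is a finite linear combination of values, so pointwise
convergence suffices. -/
theorem tendsto_interpRem {ι : Type*} {F : Filter ι} (l : List (Fin n))
    {f : ι → (Fin n → ℝ) → ℝ} {g : (Fin n → ℝ) → ℝ}
    (h : ∀ x, Filter.Tendsto (fun i => f i x) F (nhds (g x))) (x : Fin n → ℝ) :
    Filter.Tendsto (fun i => interpRem t l (f i) x) F (nhds (interpRem t l g x)) := by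
  induction l generalizing x with
  | nil => exact h x
  | cons k l ih =>
    simp only [interpRem_cons, Pi.sub_apply, interp_apply]
    exact (ih x).sub (tendsto_finsetSum _ fun m _ => (ih _).const_mul _)

/-- The slices of `f` in the `k`-th variable are polynomials of degree less than `a`. -/
def PolySlices (k : Fin n) (a : ℕ) (f : (Fin n → ℝ) → ℝ) : Prop :=
  ∀ x, ∃ P ∈ Polynomial.degreeLT ℝ a, ∀ s, f (Function.update x k s) = P.eval s

theorem PolySlices.sub {k : Fin n} {a : ℕ} {f g : (Fin n → ℝ) → ℝ} (hf : PolySlices k a f)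
    (hg : PolySlices k a g) : PolySlices k a (f - g) := by
  intro x
  obtain ⟨P, hP, hP'⟩ := hf x
  obtain ⟨Q, hQ, hQ'⟩ := hg x
  exact ⟨P - Q, sub_mem hP hQ, fun s => by simp [hP', hQ']⟩

theorem basis_mem_degreeLT {a : ℕ} {t : Fin a → ℝ} (ht : Function.Injective t) (m : Fin a) :
    Lagrange.basis Finset.univ t m ∈ Polynomial.degreeLT ℝ a := by
  rw [Polynomial.mem_degreeLT, Lagrange.degree_basis ht.injOn (Finset.mem_univ m)]
  have := m.pos
  simp only [Finset.card_univ, Fintype.card_fin]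
  exact_mod_cast (by lia : a - 1 < a)

theorem polySlices_interp (k : Fin n) {a : ℕ} {t : Fin a → ℝ} (ht : Function.Injective t)
    (f : (Fin n → ℝ) → ℝ) : PolySlices k a (interp k t f) := by
  intro x
  refine ⟨∑ m, f (Function.update x k (t m)) • Lagrange.basis Finset.univ t m,
    Submodule.sum_mem _ fun m _ => Submodule.smul_mem _ _ (basis_mem_degreeLT ht m), fun s => ?_⟩
  simp [interp_apply, Polynomial.eval_finsetSum, mul_comm]

theorem PolySlices.interp_of_ne {i k : Fin n} (hik : i ≠ k) {a b : ℕ} {t : Fin a → ℝ}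
    {f : (Fin n → ℝ) → ℝ} (hf : PolySlices i b f) : PolySlices i b (interp k t f) := by
  intro x
  choose P hP hP' using fun m => hf (Function.update x k (t m))
  refine ⟨∑ m, (Lagrange.basis Finset.univ t m).eval (x k) • P m,
    Submodule.sum_mem _ fun m _ => Submodule.smul_mem _ _ (hP m), fun s => ?_⟩
  simp only [interp_apply, Polynomial.eval_finsetSum, Polynomial.eval_smul, smul_eq_mul, ← hP',
    Function.update_of_ne hik.symm]
  exact Finset.sum_congr rfl fun m _ => by rw [Function.update_comm hik]

theorem PolySlices.interp_eq {k : Fin n} {a : ℕ} {t : Fin a → ℝ} (ht : Function.Injective t)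
    {f : (Fin n → ℝ) → ℝ} (hf : PolySlices k a f) : interp k t f = f := by
  ext x
  obtain ⟨P, hP, hP'⟩ := hf x
  have h1 : f x = P.eval (x k) := by simpa using hP' (x k)
  have h2 := Lagrange.eq_interpolate (s := Finset.univ) (v := t) ht.injOn
    (by simpa [Polynomial.mem_degreeLT] using hP)
  rw [h1, h2, interp_apply, Lagrange.interpolate_apply, Polynomial.eval_finsetSum]
  exact Finset.sum_congr rfl fun m _ => by simp [hP', mul_comm]

theorem PolySlices.interpRem (ht : ∀ k, Function.Injective (t k)) {k : Fin n}
    {f : (Fin n → ℝ) → ℝ} (hf : PolySlices k (α k) f) (l : List (Fin n)) :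
    PolySlices k (α k) (interpRem t l f) := by
  induction l with
  | nil => exact hf
  | cons i l ih =>
    rw [interpRem_cons]
    rcases eq_or_ne k i with rfl | hki
    · exact ih.sub (polySlices_interp k (ht k) _)
    · exact ih.sub (ih.interp_of_ne hki)

/-- Interpolation in the other variables keeps the slices in `x_k` polynomial of low degree. When
the turn of `k` comes, interpolation therefore reproduces the current remainder exactly, and zero
stays zero afterwards. -/
theorem PolySlices.interpRem_eq_zero (ht : ∀ k, Function.Injective (t k)) {k : Fin n}
    {f : (Fin n → ℝ) → ℝ} (hf : PolySlices k (α k) f) {l : List (Fin n)} (hk : k ∈ l) :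
    DistrUP.interpRem t l f = 0 := by
  induction l with
  | nil => simp at hk
  | cons i l ih =>
    rw [interpRem_cons]
    rcases List.mem_cons.1 hk with rfl | h
    · rw [(hf.interpRem ht l).interp_eq (ht k), sub_self]
    · rw [ih h, map_zero, sub_zero]

theorem polySlices_of_mem_polyIn {k : Fin n} {a : ℕ} {p : CFun n} (hp : p ∈ polyIn k a) :
    PolySlices k a p := by
  intro x
  refine Submodule.span_induction (p := fun (p : CFun n) _ => ∃ P ∈ Polynomial.degreeLT ℝ a,
    ∀ s, p (Function.update x k s) = P.eval s) ?_ ?_ ?_ ?_ hp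
  · rintro _ ⟨m, hm, g, hg, rfl⟩
    refine ⟨Polynomial.C (g x) * Polynomial.X ^ m, ?_, fun s => by simp [hg x s]⟩
    rw [Polynomial.mem_degreeLT]
    exact (Polynomial.degree_C_mul_X_pow_le m _).trans_lt (by exact_mod_cast hm)
  · exact ⟨0, zero_mem _, by simp⟩
  · rintro f g _ _ ⟨P, hP, hP'⟩ ⟨Q, hQ, hQ'⟩
    exact ⟨P + Q, add_mem hP hQ, fun s => by simp [hP', hQ']⟩
  · rintro r f _ ⟨P, hP, hP'⟩
    exact ⟨r • P, Submodule.smul_mem _ _ hP, fun s => by simp [hP']⟩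

theorem polynomial_mul_mem_polyIn {k : Fin n} {a : ℕ} {P : Polynomial ℝ}
    (hP : P ∈ Polynomial.degreeLT ℝ a) {g : CFun n} (hg : IndepOf k g) :
    mulCoord k P.toContinuousMap g ∈ polyIn k a := by
  have : mulCoord k P.toContinuousMap g =
      ∑ i ∈ Finset.range a, P.coeff i • (g * coord k ^ i) := by
    ext x
    have hx := Polynomial.eval_eq_sum_range' (p := P) (n := a)
    rcases Nat.eq_zero_or_pos a with rfl | ha
    · have : P = 0 := by
        rw [Polynomial.mem_degreeLT] at hP
        exact Polynomial.degree_eq_bot.1 (Nat.WithBot.lt_zero_iff.1 hP)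
      simp [this]
    · have h2 : P.natDegree < a := by
        by_cases h0 : P = 0
        · simpa [h0] using ha
        · rw [Polynomial.mem_degreeLT] at hP
          exact (Polynomial.natDegree_lt_iff_degree_lt h0).2 hP
      simp only [mulCoord_apply, Polynomial.toContinuousMap_apply, hx h2, Finset.sum_mul,
        ContinuousMap.coe_sum, Finset.sum_apply, ContinuousMap.coe_smul, Pi.smul_apply,
        ContinuousMap.coe_mul, ContinuousMap.coe_pow, Pi.mul_apply, Pi.pow_apply, coord_apply,
        smul_eq_mul]
      exact Finset.sum_congr rfl fun i _ => by ring
  rw [this]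
  exact Submodule.sum_mem _ fun i hi => Submodule.smul_mem _ _
    (mul_coord_pow_mem_polyIn (Finset.mem_range.1 hi) hg)

theorem exists_interp_eq (k : Fin n) {a : ℕ} {t : Fin a → ℝ} (ht : Function.Injective t)
    (f : CFun n) : ∃ p ∈ polyIn k a, (p : (Fin n → ℝ) → ℝ) = interp k t f := by
  refine ⟨∑ m, mulCoord k (Lagrange.basis Finset.univ t m).toContinuousMap (evalAt k (t m) f),
    Submodule.sum_mem _ fun m _ => polynomial_mul_mem_polyIn (basis_mem_degreeLT ht m)
      (indepOf_evalAt k _ f), ?_⟩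
  ext x
  simp [interp_apply]

theorem exists_interpRem_eq (ht : ∀ k, Function.Injective (t k)) (l : List (Fin n)) (f : CFun n) :
    ∃ p ∈ ⨆ k, polyIn k (α k), ((f - p : CFun n) : (Fin n → ℝ) → ℝ) = interpRem t l f := by
  induction l with
  | nil => exact ⟨0, zero_mem _, by simp [interpRem]⟩
  | cons k l ih =>
    obtain ⟨p, hp, hp'⟩ := ih
    obtain ⟨q, hq, hq'⟩ := exists_interp_eq k (ht k) (f - p)
    refine ⟨p + q, add_mem hp (Submodule.mem_iSup_of_mem k hq), ?_⟩
    rw [interpRem_cons, ← hp', ← hq', ← sub_sub, ContinuousMap.coe_sub (f - p)]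

variable (t) in
/-- The remainder of the successive interpolations in all variables. -/
noncomputable def interpErr : Module.End ℝ ((Fin n → ℝ) → ℝ) := interpRem t (List.finRange n)

theorem interpErr_eq_zero_of_mem (ht : ∀ k, Function.Injective (t k)) {p : CFun n}
    (hp : p ∈ ⨆ k, polyIn k (α k)) : interpErr t p = 0 := by
  have : ⨆ k, polyIn k (α k) ≤ (LinearMap.ker (interpErr t)).comap
      (ContinuousMap.coeFnLinearMap ℝ : CFun n →ₗ[ℝ] ((Fin n → ℝ) → ℝ)) :=
    iSup_le fun k p hp =>
      (polySlices_of_mem_polyIn hp).interpRem_eq_zero ht (List.mem_finRange k)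
  exact this hp

/-- A function is a sum of polynomials on `B` if and only if its interpolation error vanishes
on `B`. -/
theorem mem_polySumOn_iff (ht : ∀ k, Function.Injective (t k)) {B : Set (Fin n → ℝ)}
    (hB : NodeClosed t B) {f : CFun n} :
    f ∈ polySumOn α B ↔ ∀ x ∈ B, interpErr t f x = 0 := by
  constructor
  · intro hf
    obtain ⟨p, hp, z, hz, rfl⟩ := Submodule.mem_sup.1 hf
    intro x hx
    rw [ContinuousMap.coe_add, map_add, interpErr_eq_zero_of_mem ht hp, zero_add, interpErr,
      interpRem_congr hB _ (g := 0) hz x hx, map_zero, Pi.zero_apply]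
  · intro h
    obtain ⟨p, hp, hp'⟩ := exists_interpRem_eq ht (List.finRange n) f
    rw [← add_sub_cancel p f]
    exact add_mem (Submodule.mem_sup_left hp) (zeroOn_le_polySumOn _ _ fun x hx => by
      rw [hp']; exact h x hx)

/-- Distinct nodes close to a given point. -/
theorem exists_nodes (α : Fin n → ℕ) (x : Fin n → ℝ) {η : ℝ} (hη : 0 < η) :
    ∃ t : ∀ k, Fin (α k) → ℝ, (∀ k, Function.Injective (t k)) ∧
      ∀ k m, |t k m - x k| < η := by
  refine ⟨fun k m => x k + η * (m / α k), fun k m m' h => ?_, fun k m => ?_⟩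
  · have hk : (0 : ℝ) < α k := by exact_mod_cast m.pos
    have h1 : (m : ℝ) / α k = m' / α k := by
      have := add_left_cancel h
      exact mul_left_cancel₀ hη.ne' this
    have h2 : (m : ℝ) = m' := by field_simp at h1; exact h1
    exact Fin.ext (by exact_mod_cast h2)
  · have hk : (0 : ℝ) < α k := by exact_mod_cast m.pos
    have hm : (m : ℝ) < α k := by exact_mod_cast m.2
    rw [add_sub_cancel_left, abs_of_nonneg (by positivity)]
    have : (m : ℝ) / α k < 1 := (div_lt_one hk).2 hm
    nlinarith

theorem update_mem_ball {x y : Fin n → ℝ} {ε : ℝ} (hy : y ∈ Metric.ball x ε) {k : Fin n} {s : ℝ}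
    (hs : |s - x k| < ε) : Function.update y k s ∈ Metric.ball x ε := by
  have hε : 0 < ε := (abs_nonneg _).trans_lt hs
  rw [Metric.mem_ball, dist_pi_lt_iff hε] at hy ⊢
  intro i
  rcases eq_or_ne i k with rfl | hi
  · simpa [Real.dist_eq] using hs
  · simpa [Function.update_of_ne hi] using hy i

theorem update_mem_closedBall {x y : Fin n → ℝ} {ε : ℝ} (hy : y ∈ Metric.closedBall x ε)
    {k : Fin n} {s : ℝ} (hs : |s - x k| ≤ ε) :
    Function.update y k s ∈ Metric.closedBall x ε := by
  have hε : 0 ≤ ε := (abs_nonneg _).trans hs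
  rw [Metric.mem_closedBall, dist_pi_le_iff hε] at hy ⊢
  intro i
  rcases eq_or_ne i k with rfl | hi
  · simpa [Real.dist_eq] using hs
  · simpa [Function.update_of_ne hi] using hy i

theorem abs_apply_sub_lt {x y : Fin n → ℝ} {ε : ℝ} (hy : y ∈ Metric.ball x ε) (k : Fin n) :
    |y k - x k| < ε := by
  rw [← Real.dist_eq]
  exact (dist_le_pi_dist y x k).trans_lt hy

/-- For small `h` the difference `F(· + h e_k) - F` of the antiderivative `F` is in `polySumOn γ` on
the smaller ball: polynomials in `x_k` lose one degree, those in other variables keep theirs. Hence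
the interpolation error of each difference quotient vanishes there, and so does its limit, the error
of `f`. Halving the radius leaves room for the translation. -/
theorem mem_polySumOn_of_antideriv (c : Fin n → ℝ) (k : Fin n) {γ : Fin n → ℕ} {x : Fin n → ℝ}
    {ε : ℝ} (hε : 0 < ε) {f : CFun n}
    (hf : antideriv c k f ∈ polySumOn (γ + Pi.single k 1) (Metric.ball x ε)) :
    f ∈ polySumOn γ (Metric.ball x (ε / 2)) := by
  obtain ⟨t, ht, ht'⟩ := exists_nodes γ x (half_pos hε)
  have hB : NodeClosed t (Metric.ball x (ε / 2)) := fun y hy k m => update_mem_ball hy (ht' k m)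
  rw [mem_polySumOn_iff ht hB]
  intro y hy
  set F := antideriv c k f
  have h1 : ∀ h : ℝ, |h| < ε / 2 → (transl k h - 1 : Module.End ℝ (CFun n)) F ∈
      polySumOn γ (Metric.ball x (ε / 2)) := by
    intro h hh
    refine map_mem_of_mem_polySumOn _ _ (fun i p hp => ?_) (fun p hp => ?_) hf
    · refine polyIn_le_polySumOn _ _ i ?_
      rcases eq_or_ne i k with rfl | hik
      · exact transl_sub_mem_polyIn i h (by simpa using hp)
      · rw [Pi.add_apply, Pi.single_eq_of_ne hik, add_zero] at hp
        exact sub_mem (transl_mem_polyIn_of_ne hik h hp) hp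
    · refine zeroOn_le_polySumOn _ _ fun z hz => ?_
      have h2 := abs_apply_sub_lt hz k
      have hz' := Metric.ball_subset_ball (half_le_self hε.le) hz
      have h3 : |z k + h - x k| < ε := by
        rw [abs_lt] at *; constructor <;> linarith
      simp [hp z hz', hp _ (update_mem_ball hz' h3)]
  have h2 : ∀ z, Filter.Tendsto (fun h : ℝ => (h⁻¹ • (((transl k h - 1 : Module.End ℝ (CFun n)) F :
      CFun n) : (Fin n → ℝ) → ℝ)) z) (nhdsWithin 0 {0}ᶜ) (nhds (f z)) := by
    intro z
    have := hasDerivAt_iff_tendsto_slope_zero.1 (hasDerivAt_antideriv c k f z (z k))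
    simpa using this
  have h3 := tendsto_interpRem (t := t) (List.finRange n) h2 y
  refine tendsto_nhds_unique h3 (tendsto_const_nhds.congr' ?_)
  have h4 : ∀ᶠ h : ℝ in nhdsWithin 0 {0}ᶜ, |h| < ε / 2 := by
    have := Metric.ball_mem_nhds (0 : ℝ) (half_pos hε)
    filter_upwards [mem_nhdsWithin_of_mem_nhds this] with h hh
    simpa using hh
  filter_upwards [h4] with h hh
  have := (mem_polySumOn_iff ht hB).1 (h1 h hh) y hy
  rw [map_smul, Pi.smul_apply]
  rw [interpErr] at this
  rw [this, smul_zero]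

/-- The box `J`, enlarged by `η` in all directions. -/
def enlarge (J : BoxIntegral.Box (Fin n)) (η : ℝ) : Set (Fin n → ℝ) :=
  {y | ∀ i, J.lower i - η < y i ∧ y i < J.upper i + η}

/-- Bisection of boxes, with slightly enlarged boxes so that the pieces overlap. The nodes are taken
near the centre of the box, where all enlarged pieces meet; one and the same interpolation error
then tests every piece and the whole box. -/
theorem mem_polySumOn_of_local (I : BoxIntegral.Box (Fin n)) (f : CFun n)
    (h : ∀ z ∈ BoxIntegral.Box.Icc I, ∃ ε > 0, f ∈ polySumOn α (Metric.ball z ε)) :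
    f ∈ polySumOn α (BoxIntegral.Box.Icc I) := by
  suffices ∃ η > 0, f ∈ polySumOn α (enlarge I η) by
    obtain ⟨η, hη, hf⟩ := this
    refine polySumOn_mono le_rfl (fun y hy i => ?_) hf
    have h1 := hy.1 i
    have h2 := hy.2 i
    constructor <;> linarith
  refine BoxIntegral.Box.subbox_induction_on' (p := fun I => ∃ η > 0, f ∈ polySumOn α (enlarge I η))
    I (fun J _ hJ => ?_) (fun z hz => ?_)
  · choose η hη hf using hJ
    obtain ⟨δ, hδ, hδη⟩ : ∃ δ > 0, ∀ s, δ ≤ η s := by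
      obtain ⟨s, hs⟩ := Finite.exists_min η
      exact ⟨η s, hη s, hs⟩
    refine ⟨δ, hδ, ?_⟩
    obtain ⟨t, ht, ht'⟩ := exists_nodes α (fun i => (J.lower i + J.upper i) / 2) hδ
    have hup : ∀ s : Set (Fin n), NodeClosed t (enlarge (J.splitCenterBox s) δ) := by
      intro s y hy k m i
      rcases eq_or_ne i k with rfl | hi
      · have h1 := abs_lt.1 (ht' i m)
        have h2 := J.lower_lt_upper i
        simp only [Function.update_self, BoxIntegral.Box.splitCenterBox, Set.piecewise] at h1 ⊢
        split_ifs <;> constructor <;> linarith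
      · rw [Function.update_of_ne hi]; exact hy i
    have hJ : NodeClosed t (enlarge J δ) := by
      intro y hy k m i
      rcases eq_or_ne i k with rfl | hi
      · have h1 := abs_lt.1 (ht' i m)
        have h2 := J.lower_lt_upper i
        simp only [Function.update_self]
        constructor <;> linarith
      · rw [Function.update_of_ne hi]; exact hy i
    rw [mem_polySumOn_iff ht hJ]
    intro y hy
    let s : Set (Fin n) := {i | (J.lower i + J.upper i) / 2 < y i}
    have hys : y ∈ enlarge (J.splitCenterBox s) δ := by
      intro i
      have h1 := hy i
      simp only [BoxIntegral.Box.splitCenterBox, Set.piecewise]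
      split_ifs with hi
      · have : (J.lower i + J.upper i) / 2 < y i := hi
        constructor <;> linarith
      · have : y i ≤ (J.lower i + J.upper i) / 2 := not_lt.1 hi
        constructor <;> linarith
    refine (mem_polySumOn_iff ht (hup s)).1 (polySumOn_mono le_rfl (fun w hw i => ?_) (hf s)) y hys
    have h1 := hw i
    have h2 := hδη s
    constructor <;> linarith
  · obtain ⟨ε, hε, hf⟩ := h z hz
    refine ⟨Metric.ball z (ε / 2), mem_nhdsWithin_of_mem_nhds (Metric.ball_mem_nhds z (half_pos hε)),
      fun J _ m _ hJ _ => ⟨ε / 2, half_pos hε, polySumOn_mono le_rfl (fun y hy => ?_) hf⟩⟩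
    rw [Metric.mem_ball, dist_pi_lt_iff hε]
    intro i
    have h1 := abs_lt.1 (abs_apply_sub_lt (hJ J.lower_mem_Icc) i)
    have h2 := abs_lt.1 (abs_apply_sub_lt (hJ J.upper_mem_Icc) i)
    have h3 := hy i
    rw [Real.dist_eq, abs_lt]
    constructor <;> linarith

end Interpolation

/-! ### Sums of polynomials on intervals: from local to global -/

section PolySum

variable {n : ℕ}

theorem IsPolyIn.add {U : Opens (Rn n)} {k : Fin n} {d : ℕ} {θ η : C(U, ℝ)}
    (hθ : IsPolyIn k d θ) (hη : IsPolyIn k d η) : IsPolyIn k d (θ + η) := by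
  obtain ⟨c, hc, hc'⟩ := hθ
  obtain ⟨e, he, he'⟩ := hη
  refine ⟨fun m => c m + e m, fun m x y hxy => ?_, fun x => ?_⟩
  · simp [hc m x y hxy, he m x y hxy]
  · simp [hc', he', add_mul, Finset.sum_add_distrib]

theorem IsPolyIn.zero {U : Opens (Rn n)} (k : Fin n) (d : ℕ) : IsPolyIn k d (0 : C(U, ℝ)) :=
  ⟨0, fun _ _ _ _ => rfl, by simp⟩

theorem exists_isPolyIn_interp {U : Opens (Rn n)} {k : Fin n} {a : ℕ} {t : Fin a → ℝ}
    (ht : Function.Injective t) (hU : ∀ x ∈ U, ∀ m, Function.update x k (t m) ∈ U)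
    {f : (Fin n → ℝ) → ℝ} (hf : ContinuousOn f (U : Set (Fin n → ℝ))) :
    ∃ θ : C(U, ℝ), IsPolyIn k a θ ∧ ∀ x : U, θ x = interp k t f x.1 := by
  have hc : ∀ m, Continuous fun x : U => f (Function.update x.1 k (t m)) := fun m =>
    hf.comp_continuous (continuous_subtype_val.update k continuous_const) fun x => hU x.1 x.2 m
  let c : Fin a → C(U, ℝ) := fun i =>
    ⟨fun x => ∑ m, (Lagrange.basis Finset.univ t m).coeff i * f (Function.update x.1 k (t m)),
      continuous_finsetSum _ fun m _ => continuous_const.mul (hc m)⟩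
  refine ⟨⟨fun x => ∑ i : Fin a, c i x * x.1 k ^ (i : ℕ), continuous_finsetSum _ fun i _ =>
    (c i).continuous.mul (((continuous_apply k).comp continuous_subtype_val).pow _)⟩,
    ⟨c, fun i x y hxy => ?_, fun x => rfl⟩, fun x => ?_⟩
  · have h : ∀ s, Function.update x.1 k s = Function.update y.1 k s := fun s => by
      ext j
      rcases eq_or_ne j k with rfl | hj
      · simp
      · simp [Function.update_of_ne hj, hxy j hj]
    simp [c, h]
  · simp only [c, ContinuousMap.coe_mk, interp_apply, Finset.sum_mul]
    rw [Finset.sum_comm]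
    refine Finset.sum_congr rfl fun m _ => ?_
    have hd : (Lagrange.basis Finset.univ t m).natDegree < a := by
      rw [Lagrange.natDegree_basis ht.injOn (Finset.mem_univ m)]
      have := m.pos
      simp only [Finset.card_univ, Fintype.card_fin]; lia
    rw [Polynomial.eval_eq_sum_range' hd, Finset.sum_range, Finset.sum_mul]
    exact Finset.sum_congr rfl fun i _ => by ring

/-- A continuous function on an open `U` need not extend to `ℝⁿ`, so the polynomials are built on
`U` itself. -/
theorem exists_isPolyIn_interpRem {U : Opens (Rn n)} {α : Fin n → ℕ} {t : ∀ k, Fin (α k) → ℝ}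
    (ht : ∀ k, Function.Injective (t k)) (hU : NodeClosed t (U : Set (Fin n → ℝ)))
    {f : (Fin n → ℝ) → ℝ} (hf : ContinuousOn f (U : Set (Fin n → ℝ))) (l : List (Fin n)) :
    ∃ θ : Fin n → C(U, ℝ), (∀ k, IsPolyIn k (α k) (θ k)) ∧
      ∀ x : U, interpRem t l f x.1 = f x.1 - (∑ k, θ k) x := by
  induction l with
  | nil => exact ⟨0, fun k => IsPolyIn.zero _ _, fun x => by simp [interpRem]⟩
  | cons k l ih =>
    obtain ⟨θ, hθ, hθ'⟩ := ih
    have hcont : ContinuousOn (interpRem t l f) (U : Set (Fin n → ℝ)) := by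
      rw [continuousOn_iff_continuous_domRestrict] at hf ⊢
      refine (hf.sub (∑ k, θ k).continuous).congr fun x => (hθ' x).symm
    obtain ⟨η, hη, hη'⟩ := exists_isPolyIn_interp (ht k) (fun x hx m => hU x hx k m) hcont
    refine ⟨θ + Pi.single k η, fun i => ?_, fun x => ?_⟩
    · rcases eq_or_ne i k with rfl | hi
      · simpa using (hθ i).add hη
      · simpa [Pi.single_eq_of_ne hi] using hθ i
    · simp only [interpRem_cons, Pi.sub_apply, hθ', ← hη', Pi.add_apply, Finset.sum_add_distrib,
        ContinuousMap.add_apply]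
      rw [Finset.sum_pi_single' k η, if_pos (Finset.mem_univ k)]
      ring

/-- Extension of a continuous function from a closed subset of its domain. -/
theorem exists_extension {U : Opens (Rn n)} (f : C(U, ℝ)) {K : Set (Fin n → ℝ)}
    (hK : IsClosed K) (hKU : K ⊆ (U : Set (Fin n → ℝ))) :
    ∃ F : CFun n, ∀ (y : Fin n → ℝ) (hy : y ∈ K), F y = f ⟨y, hKU hy⟩ := by
  obtain ⟨F, hF⟩ := ContinuousMap.exists_restrict_eq hK
    (f.comp ⟨Set.inclusion hKU, continuous_inclusion hKU⟩)
  exact ⟨F, fun y hy => DFunLike.congr_fun hF ⟨y, hy⟩⟩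

theorem IsInterval.exists_ball {U : Opens (Rn n)} (hU : IsInterval U) :
    ∃ c r, 0 < r ∧ (U : Set (Fin n → ℝ)) = Metric.ball c r := by
  obtain ⟨c, r, hr, h⟩ := hU
  refine ⟨c, r, hr, ?_⟩
  rw [h, ball_pi c hr]
  simp only [Real.ball_eq_Ioo]

theorem isInterval_of_eq_ball {U : Opens (Rn n)} {c : Fin n → ℝ} {r : ℝ} (hr : 0 < r)
    (h : (U : Set (Fin n → ℝ)) = Metric.ball c r) : IsInterval U := by
  refine ⟨c, r, hr, ?_⟩
  rw [h, ball_pi c hr]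
  simp only [Real.ball_eq_Ioo]

/-- A function that is locally a sum of polynomials is one on every interval. -/
theorem isPolySum_of_local {U : Opens (Rn n)} (hU : IsInterval U) {α : Fin n → ℕ} (f : C(U, ℝ))
    (h : ∀ x ∈ U, ∃ g : CFun n, ∃ ε > 0,
      (∀ y (hy : y ∈ U), y ∈ Metric.ball x ε → g y = f ⟨y, hy⟩) ∧
      g ∈ polySumOn α (Metric.ball x ε)) : IsPolySum α f := by
  classical
  obtain ⟨c, r, hr, hUc⟩ := hU.exists_ball
  have hUc' : ∀ y, y ∈ U ↔ y ∈ Metric.ball c r := fun y => by rw [← hUc]; rfl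
  obtain ⟨t, ht, ht'⟩ := exists_nodes α c (half_pos hr)
  let f0 : (Fin n → ℝ) → ℝ := fun y => if hy : y ∈ U then f ⟨y, hy⟩ else 0
  have hf0 : ∀ y (hy : y ∈ U), f0 y = f ⟨y, hy⟩ := fun y hy => dif_pos hy
  have hf0c : ContinuousOn f0 (U : Set (Fin n → ℝ)) := by
    rw [continuousOn_iff_continuous_domRestrict]
    exact f.continuous.congr fun y => (hf0 y.1 y.2).symm
  have hUn : NodeClosed t (U : Set (Fin n → ℝ)) := by
    rw [hUc]
    exact fun y hy k m => update_mem_ball hy ((ht' k m).trans (half_lt_self hr))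
  obtain ⟨θ, hθ, hθ'⟩ := exists_isPolyIn_interpRem ht hUn hf0c (List.finRange n)
  refine ⟨θ, hθ, ContinuousMap.ext fun x => ?_⟩
  have hx := hθ' x
  rw [hf0 x.1 x.2] at hx
  suffices interpErr t f0 x.1 = 0 by
    rw [interpErr] at this
    rw [this] at hx
    exact sub_eq_zero.1 hx.symm
  -- The closed ball of radius `s` contains `x` and, as `r / 2 ≤ s`, all nodes. The larger radius
  -- `s'` makes the extension `F` agree with `f` on a neighbourhood of that ball.
  obtain ⟨s, hs1, hs2, hsr⟩ : ∃ s, dist x.1 c ≤ s ∧ r / 2 ≤ s ∧ s < r :=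
    ⟨max (dist x.1 c) (r / 2), le_max_left _ _, le_max_right _ _,
      max_lt ((hUc' _).1 x.2) (half_lt_self hr)⟩
  obtain ⟨s', hss', hs'r⟩ := exists_between hsr
  have hsub : Metric.closedBall c s' ⊆ (U : Set (Fin n → ℝ)) := by
    rw [hUc]; exact Metric.closedBall_subset_ball hs'r
  obtain ⟨F, hF⟩ := exists_extension f Metric.isClosed_closedBall hsub
  have hs0 : 0 < s := (half_pos hr).trans_le hs2
  let I : BoxIntegral.Box (Fin n) := ⟨fun i => c i - s, fun i => c i + s, fun i => by linarith⟩
  have hI : BoxIntegral.Box.Icc I = Metric.closedBall c s := by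
    rw [closedBall_pi c hs0.le, BoxIntegral.Box.Icc_eq_pi]
    simp only [Real.closedBall_eq_Icc, I]
  have hFI : F ∈ polySumOn α (Metric.closedBall c s) := by
    rw [← hI]
    refine mem_polySumOn_of_local I F fun z hz => ?_
    rw [hI] at hz
    have hz' : z ∈ Metric.ball c s' := Metric.closedBall_subset_ball hss' hz
    obtain ⟨g, ε, hε, hg, hg'⟩ := h z (hsub (Metric.ball_subset_closedBall hz'))
    obtain ⟨δ, hδ, hδs⟩ := Metric.isOpen_iff.1 Metric.isOpen_ball z hz'
    refine ⟨min δ ε, lt_min hδ hε, ?_⟩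
    rw [← add_sub_cancel g F]
    refine add_mem (polySumOn_mono le_rfl (Metric.ball_subset_ball (min_le_right _ _)) hg')
      (zeroOn_le_polySumOn _ _ fun y hy => ?_)
    have hy' := Metric.ball_subset_closedBall
      (hδs (Metric.ball_subset_ball (min_le_left _ _) hy))
    rw [ContinuousMap.sub_apply, hF y hy', hg y (hsub hy')
      (Metric.ball_subset_ball (min_le_right _ _) hy), sub_self]
  have hn : NodeClosed t (Metric.closedBall c s) := fun y hy k m =>
    update_mem_closedBall hy ((ht' k m).le.trans hs2)
  rw [interpErr, interpRem_congr hn _ (g := F) (fun y hy => ?_) x.1 hs1]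
  · exact (mem_polySumOn_iff ht hn).1 hFI x.1 hs1
  · have hy' := Metric.closedBall_subset_closedBall hss'.le hy
    rw [hF y hy', hf0 y (hsub hy')]

end PolySum

/-! ### Ordered products of powers and induction on multi-indices -/

section PowProd

variable {n : ℕ} {M : Type*} [Monoid M]

/-- The ordered product of powers of a family. -/
def powProd (d : Fin n → M) (α : Fin n → ℕ) : M := (List.ofFn fun k => d k ^ α k).prod

@[simp] theorem powProd_zero (d : Fin n → M) : powProd d 0 = 1 := by
  refine List.prod_eq_one fun x hx => ?_
  obtain ⟨k, rfl⟩ := (List.mem_ofFn' _ _).1 hx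
  simp

theorem powProd_succ (d : Fin (n + 1) → M) (α : Fin (n + 1) → ℕ) :
    powProd d α = d 0 ^ α 0 * powProd (fun k => d k.succ) fun k => α k.succ := by
  simp [powProd, List.ofFn_succ]

theorem powProd_mem (S : Submonoid M) {d : Fin n → M} (h : ∀ k, d k ∈ S) (α : Fin n → ℕ) :
    powProd d α ∈ S := by
  refine S.list_prod_mem fun x hx => ?_
  obtain ⟨k, rfl⟩ := (List.mem_ofFn' _ _).1 hx
  exact S.pow_mem (h k) _

theorem commute_powProd {d : Fin n → M} {a : M} (h : ∀ k, Commute a (d k)) (α : Fin n → ℕ) :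
    Commute a (powProd d α) := by
  have := powProd_mem (Submonoid.centralizer {a}) (d := d) (fun k => by
    rw [Submonoid.mem_centralizer_iff]
    rintro _ rfl
    exact h k) α
  exact Submonoid.mem_centralizer_iff.1 this a rfl

theorem powProd_add {d : Fin n → M} (hd : ∀ i k, Commute (d i) (d k)) (α β : Fin n → ℕ) :
    powProd d (α + β) = powProd d α * powProd d β := by
  induction n with
  | zero => simp [powProd]
  | succ n ih =>
    have h1 := ih (d := fun k => d k.succ) (fun i k => hd _ _) (fun k => α k.succ)
      (fun k => β k.succ)
    have h2 : Commute (d 0 ^ β 0) (powProd (fun k => d k.succ) fun k => α k.succ) :=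
      commute_powProd (fun k => (hd 0 k.succ).pow_left _) _
    rw [powProd_succ, powProd_succ d α, powProd_succ d β, Pi.add_apply, pow_add]
    change _ * powProd (fun k => d k.succ) ((fun k => α k.succ) + fun k => β k.succ) = _
    rw [h1, mul_assoc, mul_assoc, ← mul_assoc (d 0 ^ β 0), h2.eq, mul_assoc]

@[simp] theorem powProd_single_one (d : Fin n → M) (k : Fin n) :
    powProd d (Pi.single k 1) = d k := by
  induction n with
  | zero => exact k.elim0
  | succ n ih =>
    rw [powProd_succ]
    refine Fin.cases ?_ (fun k => ?_) k
    · have : (fun i : Fin n => (Pi.single 0 1 : Fin (n + 1) → ℕ) i.succ) = 0 := by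
        ext i; simp
      rw [this]; simp
    · have : (fun i : Fin n => (Pi.single k.succ 1 : Fin (n + 1) → ℕ) i.succ) = Pi.single k 1 := by
        ext i
        simp [Pi.single_apply, Fin.succ_inj]
      rw [this, ih, Pi.single_eq_of_ne (Fin.succ_ne_zero k).symm, pow_zero, one_mul]

/-- A linear map that intertwines two families of endomorphisms intertwines their products. -/
theorem map_powProd {V W : Type*} [AddCommGroup V] [Module ℝ V] [AddCommGroup W] [Module ℝ W]
    (φ : V →ₗ[ℝ] W) {d : Fin n → Module.End ℝ V} {e : Fin n → Module.End ℝ W}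
    (h : ∀ k v, φ (d k v) = e k (φ v)) (α : Fin n → ℕ) (v : V) :
    φ (powProd d α v) = powProd e α (φ v) := by
  have hp : ∀ k m v, φ ((d k ^ m) v) = (e k ^ m) (φ v) := by
    intro k m
    induction m with
    | zero => intro v; rfl
    | succ m ih => intro v; rw [pow_succ, pow_succ, Module.End.mul_apply, Module.End.mul_apply, ih, h]
  induction n with
  | zero => rfl
  | succ n ih =>
    rw [powProd_succ, powProd_succ, Module.End.mul_apply, Module.End.mul_apply, hp,
      ih (fun k v => h _ v) (fun k => α k.succ) fun k m v => hp _ _ _]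

theorem multiindex_induction {P : (Fin n → ℕ) → Prop} (h0 : P 0)
    (h1 : ∀ β k, P β → P (β + Pi.single k 1)) (β : Fin n → ℕ) : P β := by
  induction hs : ∑ k, β k generalizing β with
  | zero =>
    have : β = 0 := by
      ext k
      exact (Finset.sum_eq_zero_iff.1 hs) k (Finset.mem_univ k)
    rwa [this]
  | succ m ih =>
    obtain ⟨k, hk⟩ : ∃ k, β k ≠ 0 := by
      by_contra! h
      simp [h] at hs
    have hle : Pi.single k 1 ≤ β := by
      intro i
      rcases eq_or_ne i k with rfl | hi
      · simp; lia
      · simp [Pi.single_eq_of_ne hi]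
    have hβ : β - Pi.single k 1 + Pi.single k 1 = β := tsub_add_cancel_of_le hle
    rw [← hβ]
    refine h1 _ _ (ih _ ?_)
    rw [← hβ] at hs
    simp only [Pi.add_apply, Finset.sum_add_distrib, Finset.sum_pi_single', Finset.mem_univ,
      if_true] at hs
    lia

end PowProd

/-! ### Iterated antiderivatives -/

section Antiderivatives

variable {n : ℕ}

/-- Iterated antiderivatives. -/
noncomputable def antiderivs (c : Fin n → ℝ) (β : Fin n → ℕ) : Module.End ℝ (CFun n) :=
  powProd (antideriv c) β

@[simp] theorem antiderivs_zero (c : Fin n → ℝ) : antiderivs c 0 = 1 := powProd_zero _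

theorem antiderivs_add (c : Fin n → ℝ) (α β : Fin n → ℕ) :
    antiderivs c (α + β) = antiderivs c α * antiderivs c β :=
  powProd_add (antideriv_comm c) α β

@[simp] theorem antiderivs_single (c : Fin n → ℝ) (k : Fin n) :
    antiderivs c (Pi.single k 1) = antideriv c k := powProd_single_one _ _

theorem antiderivs_add_single (c : Fin n → ℝ) (β : Fin n → ℕ) (k : Fin n) (f : CFun n) :
    antiderivs c (β + Pi.single k 1) f = antideriv c k (antiderivs c β f) := by
  rw [add_comm, antiderivs_add, antiderivs_single, Module.End.mul_apply]

theorem update_mem_ball_of_mem_uIcc {x y : Fin n → ℝ} {ε : ℝ} (hy : y ∈ Metric.ball x ε)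
    {k : Fin n} {s : ℝ} (hs : s ∈ Set.uIcc (x k) (y k)) :
    Function.update y k s ∈ Metric.ball x ε := by
  have h := abs_lt.1 (abs_apply_sub_lt hy k)
  refine update_mem_ball hy ?_
  rcases Set.mem_uIcc.1 hs with hs | hs <;> rw [abs_lt] <;> constructor <;> linarith [hs.1, hs.2]

/-- The base point is the centre of the ball, so the segment of integration stays in the ball. -/
theorem antideriv_mem_zeroOn {x : Fin n → ℝ} {ε : ℝ} (k : Fin n) {f : CFun n}
    (hf : f ∈ zeroOn (Metric.ball x ε)) : antideriv x k f ∈ zeroOn (Metric.ball x ε) := by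
  intro y hy
  rw [antideriv_apply]
  rw [intervalIntegral.integral_congr (g := fun _ => 0)
    fun t ht => hf _ (update_mem_ball_of_mem_uIcc hy ht)]
  simp

theorem antiderivs_mem_zeroOn {x : Fin n → ℝ} {ε : ℝ} (β : Fin n → ℕ) {f : CFun n}
    (hf : f ∈ zeroOn (Metric.ball x ε)) : antiderivs x β f ∈ zeroOn (Metric.ball x ε) := by
  induction β using multiindex_induction with
  | h0 => simpa
  | h1 β k ih => rw [antiderivs_add_single]; exact antideriv_mem_zeroOn k ih

theorem antiderivs_mem_polyIn (c : Fin n → ℝ) (β : Fin n → ℕ) {k : Fin n} {a : ℕ} {f : CFun n}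
    (hf : f ∈ polyIn k a) : antiderivs c β f ∈ polyIn k (a + β k) := by
  induction β using multiindex_induction with
  | h0 => simpa
  | h1 β i ih =>
    rw [antiderivs_add_single]
    rcases eq_or_ne k i with rfl | hk
    · simpa [← add_assoc] using antideriv_mem_polyIn c k ih
    · simpa [Pi.single_eq_of_ne hk] using antideriv_mem_polyIn_of_ne c hk ih

theorem antiderivs_mem_polySumOn {x : Fin n → ℝ} {ε : ℝ} {α : Fin n → ℕ} (β : Fin n → ℕ)
    {f : CFun n} (hf : f ∈ polySumOn α (Metric.ball x ε)) :
    antiderivs x β f ∈ polySumOn (α + β) (Metric.ball x ε) :=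
  map_mem_of_mem_polySumOn _ _
    (fun k _ hp => polyIn_le_polySumOn _ _ k (antiderivs_mem_polyIn x β hp))
    (fun _ hp => zeroOn_le_polySumOn _ _ (antiderivs_mem_zeroOn β hp)) hf

/-- Antiderivatives are removed one at a time; each removal halves the radius. -/
theorem mem_polySumOn_of_antiderivs {x : Fin n → ℝ} (β : Fin n → ℕ) {γ : Fin n → ℕ} {ε : ℝ}
    (hε : 0 < ε) {f : CFun n} (hf : antiderivs x β f ∈ polySumOn (γ + β) (Metric.ball x ε)) :
    ∃ ε' > 0, f ∈ polySumOn γ (Metric.ball x ε') := by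
  induction β using multiindex_induction generalizing ε with
  | h0 => exact ⟨ε, hε, by simpa using hf⟩
  | h1 β k ih =>
    rw [antiderivs_add_single, ← add_assoc] at hf
    exact ih (half_pos hε) (mem_polySumOn_of_antideriv x k hε hf)

end Antiderivatives

/-! ### Stalks of the model: formal derivatives modulo null sums -/

section Stalks

variable {n : ℕ}

/-- Formal sums of derivatives `∑ α, δ^α f_α` of continuous functions. -/
abbrev FormalSum (n : ℕ) := (Fin n → ℕ) →₀ CFun n

/-- The antiderivative of order `γ` of a formal sum of derivatives, based at `x`. -/
noncomputable def realize (x : Fin n → ℝ) (γ : Fin n → ℕ) : FormalSum n →ₗ[ℝ] CFun n :=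
  Finsupp.lsum ℝ fun α => antiderivs x (γ - α)

@[simp] theorem realize_single (x : Fin n → ℝ) (γ α : Fin n → ℕ) (f : CFun n) :
    realize x γ (Finsupp.single α f) = antiderivs x (γ - α) f := by
  simp [realize]

/-- The formal sums of derivatives that are zero near `x`. -/
noncomputable def nullSums (x : Fin n → ℝ) : Submodule ℝ (FormalSum n) where
  -- The subtraction `γ - α` in `realize` is truncated, so only a `γ` above all orders that occur in
  -- `F` is meaningful; hence the bound `γ₀`.
  carrier := {F | ∃ γ₀ : Fin n → ℕ, ∃ ε > 0, ∀ γ ≥ γ₀,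
    realize x γ F ∈ polySumOn γ (Metric.ball x ε)}
  add_mem' := by
    rintro F G ⟨γ₁, ε₁, h₁, hF⟩ ⟨γ₂, ε₂, h₂, hG⟩
    refine ⟨γ₁ ⊔ γ₂, min ε₁ ε₂, lt_min h₁ h₂, fun γ hγ => ?_⟩
    rw [map_add]
    exact add_mem
      (polySumOn_mono le_rfl (Metric.ball_subset_ball (min_le_left _ _))
        (hF γ (le_sup_left.trans hγ)))
      (polySumOn_mono le_rfl (Metric.ball_subset_ball (min_le_right _ _))
        (hG γ (le_sup_right.trans hγ)))
  zero_mem' := ⟨0, 1, one_pos, fun γ _ => by simp⟩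
  smul_mem' := by
    rintro r F ⟨γ₁, ε₁, h₁, hF⟩
    exact ⟨γ₁, ε₁, h₁, fun γ hγ => by
      rw [map_smul]; exact Submodule.smul_mem _ _ (hF γ hγ)⟩

/-- Formal derivative of a formal sum of derivatives. -/
noncomputable def shift (k : Fin n) : Module.End ℝ (FormalSum n) :=
  Finsupp.lmapDomain (CFun n) ℝ fun α => α + Pi.single k 1

@[simp] theorem shift_single (k : Fin n) (α : Fin n → ℕ) (f : CFun n) :
    shift k (Finsupp.single α f) = Finsupp.single (α + Pi.single k 1) f := by
  simp [shift]

theorem realize_shift (x : Fin n → ℝ) (γ : Fin n → ℕ) (k : Fin n) (F : FormalSum n) :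
    realize x γ (shift k F) = realize x (γ - Pi.single k 1) F := by
  have : realize x γ ∘ₗ shift k = realize x (γ - Pi.single k 1) := by
    refine Finsupp.lhom_ext fun α f => ?_
    simp only [LinearMap.comp_apply, shift_single, realize_single]
    rw [tsub_add_eq_tsub_tsub_swap]
  exact LinearMap.congr_fun this F

theorem shift_mem_nullSums (x : Fin n → ℝ) (k : Fin n) :
    nullSums x ≤ (nullSums x).comap (shift k) := by
  rintro F ⟨γ₀, ε, hε, hF⟩
  refine ⟨γ₀ + Pi.single k 1, ε, hε, fun γ hγ => ?_⟩
  rw [realize_shift]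
  exact polySumOn_mono tsub_le_self subset_rfl (hF _ (le_tsub_of_add_le_right hγ))

/-- The stalk of generalised functions at `x`. -/
def Stalk (x : Fin n → ℝ) : Type u := ULift.{u} (FormalSum n ⧸ nullSums x)

noncomputable instance (x : Fin n → ℝ) : AddCommGroup (Stalk.{u} x) :=
  inferInstanceAs (AddCommGroup (ULift.{u} (FormalSum n ⧸ nullSums x)))

noncomputable instance (x : Fin n → ℝ) : Module ℝ (Stalk.{u} x) :=
  inferInstanceAs (Module ℝ (ULift.{u} (FormalSum n ⧸ nullSums x)))

/-- The class of a formal sum in the stalk. -/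
noncomputable def stalkMk (x : Fin n → ℝ) : FormalSum n →ₗ[ℝ] Stalk.{u} x :=
  (ULift.moduleEquiv (R := ℝ) (M := FormalSum n ⧸ nullSums x)).symm.toLinearMap ∘ₗ
    (nullSums x).mkQ

theorem stalkMk_surjective (x : Fin n → ℝ) : Function.Surjective (stalkMk.{u} x) :=
  (ULift.moduleEquiv (R := ℝ) (M := FormalSum n ⧸ nullSums x)).symm.surjective.comp
    (Submodule.mkQ_surjective _)

theorem stalkMk_eq_zero {x : Fin n → ℝ} {F : FormalSum n} :
    stalkMk.{u} x F = 0 ↔ F ∈ nullSums x := by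
  rw [← Submodule.ker_mkQ (nullSums x), LinearMap.mem_ker]
  exact (ULift.moduleEquiv (R := ℝ) (M := FormalSum n ⧸ nullSums x)).symm.map_eq_zero_iff

/-- The derivatives on the stalk. -/
noncomputable def stalkD (x : Fin n → ℝ) (k : Fin n) : Module.End ℝ (Stalk.{u} x) :=
  (ULift.moduleEquiv (R := ℝ) (M := FormalSum n ⧸ nullSums x)).symm.toLinearMap ∘ₗ
    (nullSums x).mapQ (nullSums x) (shift k) (shift_mem_nullSums x k) ∘ₗ
    (ULift.moduleEquiv (R := ℝ) (M := FormalSum n ⧸ nullSums x)).toLinearMap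

theorem stalkD_mk (x : Fin n → ℝ) (k : Fin n) (F : FormalSum n) :
    stalkD.{u} x k (stalkMk x F) = stalkMk x (shift k F) := rfl

theorem stalkD_comm (x : Fin n → ℝ) (i k : Fin n) : Commute (stalkD.{u} x i) (stalkD x k) := by
  refine LinearMap.ext fun s => ?_
  obtain ⟨F, rfl⟩ := stalkMk_surjective x s
  simp only [Module.End.mul_apply, stalkD_mk]
  congr 1
  have : shift i ∘ₗ shift k = shift k ∘ₗ shift i := by
    refine Finsupp.lhom_ext fun α f => ?_
    simp only [LinearMap.comp_apply, shift_single, add_right_comm]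
  exact LinearMap.congr_fun this F

/-- The class of a continuous function in the stalk. -/
noncomputable def stalkFun (x : Fin n → ℝ) : CFun n →ₗ[ℝ] Stalk.{u} x :=
  stalkMk x ∘ₗ Finsupp.lsingle 0

theorem powProd_stalkD (x : Fin n → ℝ) (α : Fin n → ℕ) (f : CFun n) :
    powProd (stalkD.{u} x) α (stalkFun x f) = stalkMk x (Finsupp.single α f) := by
  induction α using multiindex_induction with
  | h0 => simp [stalkFun]
  | h1 α k ih =>
    rw [add_comm, powProd_add (stalkD_comm x), powProd_single_one, Module.End.mul_apply, ih,
      stalkD_mk, shift_single, add_comm]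

/-- The decisive property of the model: passing to formal derivatives kills nothing beyond what the
polynomial axiom demands. -/
theorem powProd_stalkD_eq_zero {x : Fin n → ℝ} {α : Fin n → ℕ} {f : CFun n} :
    powProd (stalkD.{u} x) α (stalkFun x f) = 0 ↔
      ∃ ε > 0, f ∈ polySumOn α (Metric.ball x ε) := by
  rw [powProd_stalkD, stalkMk_eq_zero]
  constructor
  · rintro ⟨γ₀, ε, hε, h⟩
    -- This order is at least `γ₀` and exceeds `α` by exactly `γ₀`, so no truncation occurs.
    have h1 := h (α + γ₀) (le_add_left le_rfl)
    rw [realize_single, add_tsub_cancel_left] at h1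
    exact mem_polySumOn_of_antiderivs γ₀ hε h1
  · rintro ⟨ε, hε, h⟩
    refine ⟨α, ε, hε, fun γ hγ => ?_⟩
    rw [realize_single]
    simpa [add_tsub_cancel_of_le hγ] using antiderivs_mem_polySumOn (γ - α) h

theorem stalkFun_eq {x : Fin n → ℝ} {f g : CFun n} {ε : ℝ} (hε : 0 < ε)
    (h : ∀ y ∈ Metric.ball x ε, f y = g y) : stalkFun.{u} x f = stalkFun x g := by
  rw [← sub_eq_zero, ← map_sub]
  have : f - g ∈ polySumOn 0 (Metric.ball x ε) :=
    zeroOn_le_polySumOn _ _ fun y hy => by simp [h y hy]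
  simpa using powProd_stalkD_eq_zero.2 ⟨ε, hε, this⟩

/-- Near `x`, `f` and the antiderivative of `g` differ by a function independent of `x_k`, that is,
of degree less than `1` in `x_k`; further antiderivatives keep it within the permitted degree. -/
theorem stalkD_stalkFun {x : Fin n → ℝ} {k : Fin n} {f g : CFun n} {ε : ℝ} (hε : 0 < ε)
    (h : ∀ y ∈ Metric.ball x ε, f y = (evalAt k (x k) f + antideriv x k g) y) :
    stalkD.{u} x k (stalkFun x f) = stalkFun x g := by
  rw [← sub_eq_zero]
  change stalkMk x (shift k (Finsupp.single 0 f)) - stalkMk x (Finsupp.single 0 g) = 0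
  rw [← map_sub, stalkMk_eq_zero, shift_single, zero_add]
  refine ⟨Pi.single k 1, ε, hε, fun γ hγ => ?_⟩
  obtain ⟨β, rfl⟩ : ∃ β : Fin n → ℕ, γ = β + Pi.single k 1 := ⟨_, (tsub_add_cancel_of_le hγ).symm⟩
  rw [map_sub, realize_single, realize_single, add_tsub_cancel_right, tsub_zero, antiderivs_add,
    antiderivs_single, Module.End.mul_apply, ← map_sub]
  have h1 : f - antideriv x k g = evalAt k (x k) f +
      (f - (evalAt k (x k) f + antideriv x k g)) := by abel
  rw [h1, map_add]
  refine add_mem (polyIn_le_polySumOn _ _ k ?_) (zeroOn_le_polySumOn _ _ ?_)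
  · have := antiderivs_mem_polyIn x β ((indepOf_evalAt k (x k) f).mem_polyIn one_pos)
    simpa [add_comm] using this
  · refine antiderivs_mem_zeroOn β fun y hy => ?_
    rw [ContinuousMap.sub_apply, h y hy, sub_self]

end Stalks

/-! ### Restriction, morphisms and separation for sheaves -/

section SheafLemmas

variable {n : ℕ}

theorem secMap_secRes {H H' : VectSheaf.{u} n} (ψ : H ⟶ H') {U V : Opens (Rn n)} (hVU : V ≤ U)
    (w : Sec H U) : secMap ψ V (secRes H hVU w) = secRes H' hVU (secMap ψ U w) := by
  have := ψ.hom.naturality (homOfLE hVU).op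
  exact LinearMap.congr_fun (congrArg ModuleCat.Hom.hom this) w

theorem secRes_secRes (H : VectSheaf.{u} n) {U V W : Opens (Rn n)} (hVU : V ≤ U) (hWV : W ≤ V)
    (w : Sec H U) : secRes H hWV (secRes H hVU w) = secRes H (hWV.trans hVU) w := by
  have := H.presheaf.map_comp (homOfLE hVU).op (homOfLE hWV).op
  exact (LinearMap.congr_fun (congrArg ModuleCat.Hom.hom this) w).symm

@[simp] theorem secRes_self (H : VectSheaf.{u} n) {U : Opens (Rn n)} (h : U ≤ U) (w : Sec H U) :
    secRes H h w = w := by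
  have := H.presheaf.map_id (op U)
  exact LinearMap.congr_fun (congrArg ModuleCat.Hom.hom this) w

theorem iterD_eq_powProd {H : VectSheaf.{u} n} (δ : Fin n → (H ⟶ H)) (α : Fin n → ℕ)
    (U : Opens (Rn n)) :
    iterD δ α U = powProd (fun k => (secMap (δ k) U : Module.End ℝ (Sec H U))) α := rfl

theorem secRes_iterD {H : VectSheaf.{u} n} (δ : Fin n → (H ⟶ H)) (α : Fin n → ℕ)
    {U V : Opens (Rn n)} (hVU : V ≤ U) (w : Sec H U) :
    secRes H hVU (iterD δ α U w) = iterD δ α V (secRes H hVU w) :=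
  map_powProd _ (fun k v => (secMap_secRes (δ k) hVU v).symm) α w

theorem secMap_iterD {H H' : VectSheaf.{u} n} {δ : Fin n → (H ⟶ H)} {δ' : Fin n → (H' ⟶ H')}
    {ψ : H ⟶ H'} (h : ∀ k, δ k ≫ ψ = ψ ≫ δ' k) (α : Fin n → ℕ) (U : Opens (Rn n))
    (w : Sec H U) : secMap ψ U (iterD δ α U w) = iterD δ' α U (secMap ψ U w) :=
  map_powProd _ (fun k v => by
    have := congrArg (fun φ : H ⟶ H' => secMap φ U v) (h k)
    exact this) α w

theorem eq_of_locally_eq (H : VectSheaf.{u} n) {U : Opens (Rn n)} {s t : Sec H U}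
    (h : ∀ x ∈ U, ∃ V : Opens (Rn n), ∃ hV : V ≤ U, x ∈ V ∧ secRes H hV s = secRes H hV t) :
    s = t := by
  choose V hV hxV hst using fun x : U => h x.1 x.2
  refine TopCat.Sheaf.eq_of_locally_eq' H V U (fun x => homOfLE (hV x)) ?_ s t hst
  exact fun x hx => Opens.mem_iSup.2 ⟨⟨x, hx⟩, hxV _⟩

end SheafLemmas

/-! ### The sheaf of arbitrary families of stalk elements -/

section ProductSheaf

variable {n : ℕ} (S : (Fin n → ℝ) → Type u) [∀ x, AddCommGroup (S x)] [∀ x, Module ℝ (S x)]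

/-- The presheaf of all families of elements of the stalks `S x`. -/
def familyPresheaf : TopCat.Presheaf (ModuleCat.{u} ℝ) (Rn n) where
  obj U := ModuleCat.of ℝ (∀ x : U.unop, S x.1)
  map {U V} i := ModuleCat.ofHom
    { toFun := fun s x => s ⟨x.1, i.unop.le x.2⟩
      map_add' := fun _ _ => rfl
      map_smul' := fun _ _ => rfl }

theorem familyPresheaf_isSheaf : (familyPresheaf S).IsSheaf := by
  rw [TopCat.Presheaf.isSheaf_iff_isSheafUniqueGluing]
  intro ι U sf hsf
  choose i hi using fun x : (iSup U : Opens (Rn n)) => Opens.mem_iSup.1 x.2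
  refine ⟨fun x => sf (i x) ⟨x.1, hi x⟩, fun k => ?_, fun s hs => ?_⟩
  · funext x
    have h := hsf (i ⟨x.1, Opens.mem_iSup.2 ⟨k, x.2⟩⟩) k
    exact congrFun h ⟨x.1, hi ⟨x.1, _⟩, x.2⟩
  · funext x
    rw [← hs (i x)]
    rfl

/-- The sheaf of all families of elements of the stalks `S x`. -/
def familySheaf : VectSheaf.{u} n := ⟨familyPresheaf S, familyPresheaf_isSheaf S⟩

variable {S}

/-- The endomorphism of `familySheaf S` given by endomorphisms of the stalks. -/
def familyHom (φ : ∀ x, Module.End ℝ (S x)) : familySheaf S ⟶ familySheaf S :=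
  ObjectProperty.homMk
    { app := fun U => ModuleCat.ofHom
        { toFun := fun (s : ∀ x : U.unop, S x.1) x => φ x.1 (s x)
          map_add' := fun s t => funext fun x => map_add (φ x.1) (s x) (t x)
          map_smul' := fun r s => funext fun x => map_smul (φ x.1) r (s x) } }

/-- The value at `x` of a section of `familySheaf S`. -/
def familyEval {U : Opens (Rn n)} (x : U) : Sec (familySheaf S) U →ₗ[ℝ] S x.1 where
  toFun s := (show ∀ x : U, S x.1 from s) x
  map_add' _ _ := rfl
  map_smul' _ _ := rfl

theorem family_ext {U : Opens (Rn n)} {s t : Sec (familySheaf S) U}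
    (h : ∀ x : U, familyEval x s = familyEval x t) : s = t := funext h

theorem familyEval_iterD (φ : Fin n → ∀ x, Module.End ℝ (S x)) (α : Fin n → ℕ)
    {U : Opens (Rn n)} (x : U) (s : Sec (familySheaf S) U) :
    familyEval x (iterD (fun k => familyHom (φ k)) α U s) =
      powProd (fun k => φ k x.1) α (familyEval x s) :=
  map_powProd (familyEval x) (fun _ _ => rfl) α s

end ProductSheaf

/-! ### The model solution and the necessary polynomial condition -/

section Model

variable {n : ℕ}

theorem exists_closedBall_subset {U : Opens (Rn n)} {x : Fin n → ℝ} (hx : x ∈ U) :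
    ∃ ε > 0, Metric.closedBall x ε ⊆ (U : Set (Fin n → ℝ)) :=
  Metric.nhds_basis_closedBall.mem_iff.1 (U.isOpen.mem_nhds hx)

/-- `F` is equal to `f` near `x`. -/
def GermEq {U : Opens (Rn n)} (x : Fin n → ℝ) (F : CFun n) (f : C(U, ℝ)) : Prop :=
  ∃ ε > 0, ∀ y (_ : y ∈ Metric.ball x ε), ∃ hy : y ∈ U, F y = f ⟨y, hy⟩

theorem exists_germEq {U : Opens (Rn n)} (f : C(U, ℝ)) {x : Fin n → ℝ} (hx : x ∈ U) :
    ∃ F : CFun n, GermEq x F f := by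
  obtain ⟨ε, hε, hU⟩ := exists_closedBall_subset hx
  obtain ⟨F, hF⟩ := exists_extension f Metric.isClosed_closedBall hU
  exact ⟨F, ε, hε, fun y hy => ⟨hU (Metric.ball_subset_closedBall hy),
    hF y (Metric.ball_subset_closedBall hy)⟩⟩

theorem GermEq.stalkFun_eq {U V : Opens (Rn n)} {x : Fin n → ℝ} {F G : CFun n} {f : C(U, ℝ)}
    {g : C(V, ℝ)} (hF : GermEq x F f) (hG : GermEq x G g)
    (hfg : ∀ y (hy : y ∈ U) (hy' : y ∈ V), f ⟨y, hy⟩ = g ⟨y, hy'⟩) :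
    stalkFun.{u} x F = stalkFun x G := by
  obtain ⟨ε, hε, hF⟩ := hF
  obtain ⟨δ, hδ, hG⟩ := hG
  refine DistrUP.stalkFun_eq (lt_min hε hδ) fun y hy => ?_
  obtain ⟨h1, h1'⟩ := hF y (Metric.ball_subset_ball (min_le_left _ _) hy)
  obtain ⟨h2, h2'⟩ := hG y (Metric.ball_subset_ball (min_le_right _ _) hy)
  rw [h1', h2', hfg]

/-- The germ at `x` of a continuous function on `U`, as an element of the stalk. -/
noncomputable def germOf {U : Opens (Rn n)} (f : C(U, ℝ)) (x : U) : Stalk.{u} x.1 :=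
  stalkFun x.1 (exists_germEq f x.2).choose

theorem GermEq.germOf_eq {U : Opens (Rn n)} {f : C(U, ℝ)} {x : U} {F : CFun n}
    (h : GermEq x.1 F f) : germOf.{u} f x = stalkFun x.1 F :=
  (exists_germEq f x.2).choose_spec.stalkFun_eq h fun _ _ _ => rfl

/-- Continuous functions as generalised functions. -/
noncomputable def modelJ (n : ℕ) : C0Hom (familySheaf (Stalk.{u} (n := n))) where
  app U :=
    { toFun := fun f => (fun x : U => germOf f x : ∀ x : U, Stalk.{u} x.1)
      map_add' := fun f g => funext fun x => by
        obtain ⟨F, hF⟩ := exists_germEq f x.2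
        obtain ⟨G, hG⟩ := exists_germEq g x.2
        have hFG : GermEq x.1 (F + G) (f + g) := by
          obtain ⟨ε, hε, hF⟩ := hF
          obtain ⟨δ, hδ, hG⟩ := hG
          refine ⟨min ε δ, lt_min hε hδ, fun y hy => ?_⟩
          obtain ⟨h1, h1'⟩ := hF y (Metric.ball_subset_ball (min_le_left _ _) hy)
          obtain ⟨h2, h2'⟩ := hG y (Metric.ball_subset_ball (min_le_right _ _) hy)
          exact ⟨h1, by simp [h1', h2']⟩
        change germOf (f + g) x = germOf f x + germOf g x
        rw [hF.germOf_eq, hG.germOf_eq, hFG.germOf_eq, map_add]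
      map_smul' := fun r f => funext fun x => by
        obtain ⟨F, hF⟩ := exists_germEq f x.2
        have hrF : GermEq x.1 (r • F) (r • f) := by
          obtain ⟨ε, hε, hF⟩ := hF
          refine ⟨ε, hε, fun y hy => ?_⟩
          obtain ⟨h1, h1'⟩ := hF y hy
          exact ⟨h1, by simp [h1']⟩
        change germOf (r • f) x = r • germOf f x
        rw [hF.germOf_eq, hrF.germOf_eq, map_smul] }
  naturality U V hVU f := funext fun x => by
    change germOf (resC0 hVU f) x = germOf f ⟨x.1, hVU x.2⟩
    exact (exists_germEq (resC0 hVU f) x.2).choose_spec.stalkFun_eq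
      (exists_germEq f (hVU x.2)).choose_spec fun _ _ _ => rfl

theorem familyEval_modelJ {U : Opens (Rn n)} (f : C(U, ℝ)) (x : U) :
    familyEval x ((modelJ.{u} n).app U f) = germOf f x := rfl

/-- The partial derivatives of the model. -/
noncomputable def modelD (k : Fin n) :
    familySheaf (Stalk.{u} (n := n)) ⟶ familySheaf (Stalk.{u} (n := n)) :=
  familyHom fun x => stalkD x k

theorem familyEval_modelD {U : Opens (Rn n)} (k : Fin n)
    (s : Sec (familySheaf (Stalk.{u} (n := n))) U) (x : U) :
    familyEval x (secMap (modelD k) U s) = stalkD x.1 k (familyEval x s) := rfl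

theorem slice_hasDerivAt {U : Opens (Rn n)} {k : Fin n} {f : C(U, ℝ)} (hf : IsC1 k f) (y : U)
    {t : ℝ} (ht : Function.update y.1 k t ∈ U) :
    HasDerivAt (slice k f y.1) (partialDeriv k f ⟨Function.update y.1 k t, ht⟩) t := by
  have hopen : IsOpen (sliceDom U k y.1) :=
    U.isOpen.preimage (continuous_const.update k continuous_id)
  have h1 := ((hf.contDiffOn_slice y).contDiffAt (hopen.mem_nhds ht)).differentiableAt one_ne_zero
  refine h1.hasDerivAt.congr_deriv ?_
  -- Moving the point along the `k`-th axis does not change its slice, so the partial derivative at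
  -- the moved point is the derivative of the original slice.
  have h2 : slice k (⇑f) (Function.update y.1 k t) = slice k f y.1 := by
    funext s
    unfold slice
    congr! 1 <;> simp only [Function.update_idem]
  simp only [partialDeriv, Function.update_self, h2]

/-- The fundamental theorem of calculus on a segment inside the ball; it supplies the hypothesis of
`stalkD_stalkFun`. -/
theorem IsC1.germ_eq {U : Opens (Rn n)} {k : Fin n} {f : C(U, ℝ)} (hf : IsC1 k f) {x : U}
    {F G : CFun n} (hF : GermEq x.1 F f)
    (hG : GermEq x.1 G ⟨partialDeriv k f, hf.continuous_partialDeriv⟩) :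
    ∃ ε > 0, ∀ y ∈ Metric.ball x.1 ε, F y = (evalAt k (x.1 k) F + antideriv x.1 k G) y := by
  obtain ⟨ε, hε, hF⟩ := hF
  obtain ⟨δ, hδ, hG⟩ := hG
  refine ⟨min ε δ, lt_min hε hδ, fun y hy => ?_⟩
  have hslice : ∀ t, Function.update y k t ∈ Metric.ball x.1 (min ε δ) →
      slice k f y t = F (Function.update y k t) := by
    intro t ht
    obtain ⟨h1, h1'⟩ := hF _ (Metric.ball_subset_ball (min_le_left _ _) ht)
    rw [h1']
    exact dif_pos h1
  have hyU := (hF y (Metric.ball_subset_ball (min_le_left _ _) hy)).1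
  have h1 := intervalIntegral.integral_eq_sub_of_hasDerivAt (a := x.1 k) (b := y k)
    (f := slice k f y) (f' := fun t => G (Function.update y k t)) (fun t ht => by
      have ht' := update_mem_ball_of_mem_uIcc hy ht
      obtain ⟨h2, h2'⟩ := hG _ (Metric.ball_subset_ball (min_le_right _ _) ht')
      rw [h2']
      exact slice_hasDerivAt hf ⟨y, hyU⟩ h2) ((continuous_slice G k y).intervalIntegrable _ _)
  rw [ContinuousMap.add_apply, antideriv_apply, h1, evalAt_apply,
    hslice _ (update_mem_ball_of_mem_uIcc hy Set.right_mem_uIcc),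
    hslice _ (update_mem_ball_of_mem_uIcc hy Set.left_mem_uIcc), Function.update_eq_self]
  ring

/-- Near every point, a sum of polynomials extends to a global sum of polynomials. -/
theorem IsPolySum.mem_polySumOn {U : Opens (Rn n)} {α : Fin n → ℕ} {f : C(U, ℝ)}
    (hf : IsPolySum α f) {x : Fin n → ℝ} {F : CFun n} (hF : GermEq x F f) :
    ∃ ε > 0, F ∈ polySumOn α (Metric.ball x ε) := by
  obtain ⟨θ, hθ, rfl⟩ := hf
  obtain ⟨ε, hε, hF⟩ := hF
  have hsub : Metric.closedBall x (ε / 2) ⊆ (U : Set (Fin n → ℝ)) := fun y hy =>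
    (hF y (Metric.closedBall_subset_ball (half_lt_self hε) hy)).1
  have key : ∀ k, ∃ p ∈ polyIn k (α k), ∀ y (hy : y ∈ Metric.closedBall x (ε / 2)),
      p y = θ k ⟨y, hsub hy⟩ := by
    intro k
    obtain ⟨c, hc, hc'⟩ := hθ k
    choose C hC using fun m => exists_extension (c m) Metric.isClosed_closedBall hsub
    -- The extended coefficient `C m` may depend on `x_k` away from the ball. Freezing `x_k` at the
    -- centre restores independence and changes no value on the ball, where `c m` does not depend on
    -- `x_k`.
    refine ⟨∑ m : Fin (α k), evalAt k (x k) (C m) * coord k ^ (m : ℕ),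
      Submodule.sum_mem _ fun m _ => mul_coord_pow_mem_polyIn m.2 (indepOf_evalAt k _ _),
      fun y hy => ?_⟩
    have h0 : |x k - x k| ≤ ε / 2 := by simpa using (half_pos hε).le
    have hy' := update_mem_closedBall hy h0
    rw [hc']
    simp only [ContinuousMap.coe_sum, Finset.sum_apply, ContinuousMap.mul_apply,
      ContinuousMap.pow_apply, coord_apply, evalAt_apply]
    refine Finset.sum_congr rfl fun m _ => ?_
    rw [hC m _ hy', hc m ⟨_, hsub hy'⟩ ⟨y, hsub hy⟩ fun i hi => Function.update_of_ne hi _ _]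
  choose p hp hp' using key
  refine ⟨ε / 2, half_pos hε, ?_⟩
  rw [← add_sub_cancel (∑ k, p k) F]
  refine add_mem (Submodule.sum_mem _ fun k _ => polyIn_le_polySumOn _ _ k (hp k))
    (zeroOn_le_polySumOn _ _ fun y hy => ?_)
  obtain ⟨h1, h1'⟩ := hF y (Metric.ball_subset_ball (half_le_self hε.le) hy)
  simp [h1', hp' _ y (Metric.ball_subset_closedBall hy)]

theorem model_isSolution (n : ℕ) : IsSolution (familySheaf (Stalk.{u} (n := n)))
    (modelJ n) modelD where
  compat k U f hf := family_ext fun x => by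
    obtain ⟨F, hF⟩ := exists_germEq f x.2
    obtain ⟨G, hG⟩ := exists_germEq ⟨partialDeriv k f, hf.continuous_partialDeriv⟩ x.2
    obtain ⟨ε, hε, h⟩ := hf.germ_eq hF hG
    rw [familyEval_modelD, familyEval_modelJ, familyEval_modelJ, hF.germOf_eq, hG.germOf_eq]
    exact stalkD_stalkFun hε h
  poly α U f _ hf := family_ext fun x => by
    obtain ⟨F, hF⟩ := exists_germEq f x.2
    rw [map_zero]
    refine (familyEval_iterD _ α x _).trans ?_
    rw [familyEval_modelJ, hF.germOf_eq]
    exact powProd_stalkD_eq_zero.2 (hf.mem_polySumOn hF)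
  comm h k := by
    apply ObjectProperty.hom_ext
    refine NatTrans.ext (funext fun U => ModuleCat.hom_ext (LinearMap.ext fun s => ?_))
    refine family_ext fun x => ?_
    exact LinearMap.congr_fun (stalkD_comm x.1 k h).eq (familyEval x s)

/-- Vanishing in every stalk makes `f` a sum of polynomials near every point, which suffices on an
interval. -/
theorem isPolySum_of_model {U : Opens (Rn n)} (hU : IsInterval U) {α : Fin n → ℕ} {f : C(U, ℝ)}
    (h : iterD modelD α U ((modelJ.{u} n).app U f) = 0) : IsPolySum α f := by
  refine isPolySum_of_local hU f fun x hx => ?_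
  obtain ⟨F, hF⟩ := exists_germEq f hx
  have h1 := familyEval_iterD (fun k x => stalkD.{u} x k) α ⟨x, hx⟩ ((modelJ.{u} n).app U f)
  have h2 : familyEval (⟨x, hx⟩ : U) (iterD modelD α U ((modelJ.{u} n).app U f)) = 0 := by
    rw [h, map_zero]
  rw [familyEval_modelJ, GermEq.germOf_eq (x := ⟨x, hx⟩) hF] at h1
  obtain ⟨ε, hε, hp⟩ := powProd_stalkD_eq_zero.1 (h1.symm.trans h2)
  obtain ⟨δ, hδ, hF⟩ := hF
  refine ⟨F, min ε δ, lt_min hε hδ, fun y hy hyb => ?_,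
    polySumOn_mono le_rfl (Metric.ball_subset_ball (min_le_left _ _)) hp⟩
  exact (hF y (Metric.ball_subset_ball (min_le_right _ _) hyb)).2

/-- In a co-universal solution, functions with the same derivative of order `α` on an interval
differ by a sum of polynomials. -/
theorem IsCoUniversalSolution.isPolySum {H : VectSheaf.{u} n} {j : C0Hom H} {δ : Fin n → (H ⟶ H)}
    (hco : IsCoUniversalSolution H j δ) {α : Fin n → ℕ} {U : Opens (Rn n)} (hU : IsInterval U)
    {f : C(U, ℝ)} (h : iterD δ α U (j.app U f) = 0) : IsPolySum α f := by
  obtain ⟨ψ, hψ, -⟩ := hco.2 _ (modelJ n) modelD (model_isSolution n)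
  refine isPolySum_of_model.{u} hU ?_
  rw [← hψ.embed, ← secMap_iterD hψ.deriv, h, map_zero]

end Model

/-! ### Cutoff operators that act as multiplication after differentiation -/

section Cutoff

open scoped ContDiff

variable {n : ℕ}

/-- Smooth functions of one variable. -/
def SmoothFun : Type := {χ : ℝ → ℝ // ContDiff ℝ ∞ χ}

/-- The derivative of a smooth function. -/
noncomputable def SmoothFun.deriv (χ : SmoothFun) : SmoothFun :=
  ⟨_root_.deriv χ.1, (contDiff_infty_iff_deriv.1 χ.2).2⟩

/-- A smooth function as a continuous function. -/
def SmoothFun.toC (χ : SmoothFun) : C(ℝ, ℝ) := ⟨χ.1, χ.2.continuous⟩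

@[simp] theorem SmoothFun.toC_apply (χ : SmoothFun) (s : ℝ) : χ.toC s = χ.1 s := rfl

theorem SmoothFun.hasDerivAt (χ : SmoothFun) (s : ℝ) : HasDerivAt χ.1 (χ.deriv.1 s) s :=
  ((contDiff_infty_iff_deriv.1 χ.2).1 s).hasDerivAt

theorem SmoothFun.deriv_eq_zero {χ : SmoothFun} {v x ε : ℝ}
    (h : ∀ s, |s - x| < ε → χ.1 s = v) {s : ℝ} (hs : |s - x| < ε) : χ.deriv.1 s = 0 := by
  have h1 : χ.1 =ᶠ[nhds s] fun _ => v := by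
    have : {s | |s - x| < ε} ∈ nhds s :=
      (isOpen_lt (by fun_prop) continuous_const).mem_nhds hs
    filter_upwards [this] with y hy using h y hy
  exact h1.deriv_eq.trans (deriv_const _ _)

/-- An operator on continuous functions whose composition with the derivative of order `a` in the
`k`-th variable is this derivative followed by multiplication by `χ`. -/
noncomputable def cutoff (c : Fin n → ℝ) (k : Fin n) : ℕ → SmoothFun → Module.End ℝ (CFun n)
  | 0, χ => mulCoord k χ.toC
  | a + 1, χ => cutoff c k a χ - antideriv c k * cutoff c k a χ.deriv

theorem cutoff_succ_apply (c : Fin n → ℝ) (k : Fin n) (a : ℕ) (χ : SmoothFun) (f : CFun n) :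
    cutoff c k (a + 1) χ f = cutoff c k a χ f - antideriv c k (cutoff c k a χ.deriv f) := rfl

theorem cutoff_zero_apply (c : Fin n → ℝ) (k : Fin n) (χ : SmoothFun) (f : CFun n) :
    cutoff c k 0 χ f = mulCoord k χ.toC f := rfl

/-- Integration by parts: for `a = 0`, `χ · I q` vanishes at the base point and has derivative `χ q
+ χ' · I q`. The recursion propagates the identity to all `a`. -/
theorem cutoff_antideriv (c : Fin n → ℝ) (k : Fin n) (a : ℕ) (χ : SmoothFun) (q : CFun n) :
    cutoff c k (a + 1) χ (antideriv c k q) = antideriv c k (cutoff c k a χ q) := by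
  induction a generalizing χ with
  | zero =>
    simp only [cutoff_succ_apply, cutoff_zero_apply]
    rw [sub_eq_iff_eq_add, ← map_add]
    have := eq_antideriv_of_hasDerivAt c k (mulCoord k χ.toC (antideriv c k q))
      (mulCoord k χ.toC q + mulCoord k χ.deriv.toC (antideriv c k q)) fun x s => by
        have h := (χ.hasDerivAt s).mul (hasDerivAt_antideriv c k q x s)
        simp only [mulCoord_apply, Function.update_self, SmoothFun.toC_apply,
          ContinuousMap.add_apply]
        exact h.congr_deriv (by ring)
    have h0 : evalAt k (c k) (mulCoord k χ.toC (antideriv c k q)) = 0 := by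
      ext x
      simp [antideriv_update]
    rwa [h0, zero_add] at this
  | succ a ih => rw [cutoff_succ_apply, ih, ih, cutoff_succ_apply c k a, map_sub]

theorem cutoff_mem_polyIn_of_ne (c : Fin n → ℝ) {i k : Fin n} (hik : i ≠ k) (a : ℕ)
    (χ : SmoothFun) {b : ℕ} {p : CFun n} (hp : p ∈ polyIn i b) :
    cutoff c k a χ p ∈ polyIn i b := by
  induction a generalizing χ with
  | zero => exact mulCoord_mem_polyIn_of_ne hik _ hp
  | succ a ih => exact sub_mem (ih χ) (antideriv_mem_polyIn_of_ne c hik (ih χ.deriv))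

/-- For `a = 0` the result `χ g - I (χ' g)` is the value of `χ g` at the base point, hence
independent of `x_k`; each further step raises the degree by at most one. -/
theorem IndepOf.cutoff_mem_polyIn (c : Fin n → ℝ) {k : Fin n} (a : ℕ) (χ : SmoothFun)
    {g : CFun n} (hg : IndepOf k g) : cutoff c k (a + 1) χ g ∈ polyIn k (a + 1) := by
  induction a generalizing χ with
  | zero =>
    have := eq_antideriv_of_hasDerivAt c k (DistrUP.mulCoord k χ.toC g)
      (DistrUP.mulCoord k χ.deriv.toC g)
      fun x s => by
        have h := (χ.hasDerivAt s).mul_const (g x)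
        simpa [hg x] using h
    rw [cutoff_succ_apply, cutoff_zero_apply, cutoff_zero_apply, this, add_sub_cancel_right]
    exact (indepOf_evalAt _ _ _).mem_polyIn one_pos
  | succ a ih =>
    rw [cutoff_succ_apply]
    exact sub_mem (polyIn_mono k (Nat.le_succ _) (ih χ)) (antideriv_mem_polyIn c k (ih χ.deriv))

theorem cutoff_mem_polyIn (c : Fin n → ℝ) (k : Fin n) (a : ℕ) (χ : SmoothFun) {p : CFun n}
    (hp : p ∈ polyIn k a) : cutoff c k a χ p ∈ polyIn k a := by
  induction a generalizing p with
  | zero =>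
    rw [polyIn_zero, Submodule.mem_bot] at hp ⊢
    rw [hp, map_zero]
  | succ a ih =>
    obtain ⟨g, q, hg, hq, rfl⟩ := exists_eq_add_antideriv c k hp
    rw [map_add, cutoff_antideriv]
    exact add_mem (hg.cutoff_mem_polyIn c a χ) (antideriv_mem_polyIn c k (ih hq))

/-- The base point `c` may lie outside the ball. Moving it to `x` costs a function independent of
`x_k`, which the polynomial part absorbs. -/
theorem antideriv_mem_polyIn_sup_zeroOn (c : Fin n → ℝ) (k : Fin n) {x : Fin n → ℝ} {ε : ℝ}
    {a : ℕ} {f : CFun n} (hf : f ∈ polyIn k a ⊔ zeroOn (Metric.ball x ε)) :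
    antideriv c k f ∈ polyIn k (a + 1) ⊔ zeroOn (Metric.ball x ε) := by
  obtain ⟨p, hp, z, hz, rfl⟩ := Submodule.mem_sup.1 hf
  rw [map_add]
  refine add_mem (Submodule.mem_sup_left (antideriv_mem_polyIn c k hp)) ?_
  rw [eq_antideriv_of_hasDerivAt x k (antideriv c k z) z (hasDerivAt_antideriv c k z)]
  exact add_mem (Submodule.mem_sup_left ((indepOf_evalAt _ _ _).mem_polyIn a.succ_pos))
    (Submodule.mem_sup_right (antideriv_mem_zeroOn k hz))

/-- Either alternative passes from `χ` to `χ'`, so the recursion only meets products that vanish on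
the ball and their antiderivatives. -/
theorem cutoff_mem_polyIn_sup_zeroOn (c : Fin n → ℝ) (k : Fin n) {x : Fin n → ℝ} {ε : ℝ}
    (a : ℕ) (χ : SmoothFun) {f : CFun n}
    (h : (∀ s, |s - x k| < ε → χ.1 s = 0) ∨ f ∈ zeroOn (Metric.ball x ε)) :
    cutoff c k a χ f ∈ polyIn k a ⊔ zeroOn (Metric.ball x ε) := by
  induction a generalizing χ with
  | zero =>
    refine Submodule.mem_sup_right fun y hy => ?_
    rw [cutoff_zero_apply, mulCoord_apply]
    rcases h with h | h
    · rw [SmoothFun.toC_apply, h _ (abs_apply_sub_lt hy k), zero_mul]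
    · rw [h y hy, mul_zero]
  | succ a ih =>
    rw [cutoff_succ_apply]
    exact sub_mem (sup_le_sup_right (polyIn_mono k (Nat.le_succ _)) _ (ih χ h))
      (antideriv_mem_polyIn_sup_zeroOn c k
        (ih χ.deriv (h.imp_left fun h s hs => SmoothFun.deriv_eq_zero h hs)))

theorem cutoff_sub_mem_polyIn_sup_zeroOn (c : Fin n → ℝ) (k : Fin n) {x : Fin n → ℝ} {ε : ℝ}
    (a : ℕ) (χ : SmoothFun) (f : CFun n) (h : ∀ s, |s - x k| < ε → χ.1 s = 1) :
    cutoff c k a χ f - f ∈ polyIn k a ⊔ zeroOn (Metric.ball x ε) := by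
  induction a with
  | zero =>
    refine Submodule.mem_sup_right fun y hy => ?_
    rw [ContinuousMap.sub_apply, cutoff_zero_apply, mulCoord_apply, SmoothFun.toC_apply,
      h _ (abs_apply_sub_lt hy k), one_mul, sub_self]
  | succ a ih =>
    rw [cutoff_succ_apply, sub_right_comm]
    exact sub_mem (sup_le_sup_right (polyIn_mono k (Nat.le_succ _)) _ ih)
      (antideriv_mem_polyIn_sup_zeroOn c k (cutoff_mem_polyIn_sup_zeroOn c k a χ.deriv
        (Or.inl fun s hs => SmoothFun.deriv_eq_zero h hs)))

theorem polyIn_sup_zeroOn_le (α : Fin n → ℕ) (B : Set (Fin n → ℝ)) (k : Fin n) :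
    polyIn k (α k) ⊔ zeroOn B ≤ polySumOn α B :=
  sup_le (polyIn_le_polySumOn α B k) (zeroOn_le_polySumOn α B)

theorem cutoff_mem_polySumOn (c : Fin n → ℝ) (k : Fin n) {α : Fin n → ℕ} {x : Fin n → ℝ} {ε : ℝ}
    (χ : SmoothFun) {f : CFun n} (hf : f ∈ polySumOn α (Metric.ball x ε)) :
    cutoff c k (α k) χ f ∈ polySumOn α (Metric.ball x ε) := by
  refine map_mem_of_mem_polySumOn _ _ (fun i p hp => ?_) (fun p hp => ?_) hf
  · refine polyIn_le_polySumOn _ _ i ?_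
    rcases eq_or_ne i k with rfl | hik
    · exact cutoff_mem_polyIn c i _ χ hp
    · exact cutoff_mem_polyIn_of_ne c hik _ χ hp
  · exact polyIn_sup_zeroOn_le _ _ k (cutoff_mem_polyIn_sup_zeroOn c k _ χ (Or.inr hp))

/-- The product of the cutoff operators in all variables. -/
noncomputable def cutoffs (α : Fin n → ℕ) (χ : Fin n → SmoothFun) : Module.End ℝ (CFun n) :=
  (List.ofFn fun k => cutoff 0 k (α k) (χ k)).prod

theorem list_prod_mem_of_mem {V : Type*} [AddCommGroup V] [Module ℝ V] (S : Submodule ℝ V)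
    (l : List (Module.End ℝ V)) (h : ∀ φ ∈ l, ∀ v ∈ S, φ v ∈ S) {v : V} (hv : v ∈ S) :
    l.prod v ∈ S := by
  induction l with
  | nil => simpa
  | cons φ l ih =>
    rw [List.prod_cons, Module.End.mul_apply]
    exact h φ (by simp) _ (ih fun φ hφ => h φ (by simp [hφ]))

theorem list_prod_mem_of_exists {V : Type*} [AddCommGroup V] [Module ℝ V] (S : Submodule ℝ V)
    (l : List (Module.End ℝ V)) (h : ∀ φ ∈ l, ∀ v ∈ S, φ v ∈ S) (h' : ∃ φ ∈ l, ∀ v, φ v ∈ S)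
    (v : V) : l.prod v ∈ S := by
  induction l with
  | nil => simp at h'
  | cons φ l ih =>
    rw [List.prod_cons, Module.End.mul_apply]
    obtain ⟨ψ, hψ, hψ'⟩ := h'
    rcases List.mem_cons.1 hψ with rfl | hψ
    · exact hψ' _
    · exact h φ (by simp) _ (ih (fun φ hφ => h φ (by simp [hφ])) ⟨ψ, hψ, hψ'⟩)

theorem list_prod_sub_mem {V : Type*} [AddCommGroup V] [Module ℝ V] (S : Submodule ℝ V)
    (l : List (Module.End ℝ V)) (h : ∀ φ ∈ l, ∀ v, φ v - v ∈ S) (v : V) : l.prod v - v ∈ S := by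
  induction l with
  | nil => simp
  | cons φ l ih =>
    rw [List.prod_cons, Module.End.mul_apply, ← sub_add_sub_cancel _ (l.prod v)]
    exact add_mem (h φ (by simp) _) (ih fun φ hφ => h φ (by simp [hφ]))

theorem cutoffs_mem_polySumOn {α : Fin n → ℕ} (χ : Fin n → SmoothFun) {x : Fin n → ℝ} {ε : ℝ}
    {f : CFun n} (hf : f ∈ polySumOn α (Metric.ball x ε)) :
    cutoffs α χ f ∈ polySumOn α (Metric.ball x ε) := by
  refine list_prod_mem_of_mem _ _ (fun φ hφ v hv => ?_) hf
  obtain ⟨k, rfl⟩ := (List.mem_ofFn' _ _).1 hφ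
  exact cutoff_mem_polySumOn 0 k (χ k) hv

theorem cutoffs_mem_polySumOn_of_eq_zero {α : Fin n → ℕ} (χ : Fin n → SmoothFun)
    {x : Fin n → ℝ} {ε : ℝ} {k : Fin n} (h : ∀ s, |s - x k| < ε → (χ k).1 s = 0) (f : CFun n) :
    cutoffs α χ f ∈ polySumOn α (Metric.ball x ε) := by
  refine list_prod_mem_of_exists _ _ (fun φ hφ v hv => ?_)
    ⟨_, (List.mem_ofFn' _ _).2 ⟨k, rfl⟩, fun v => ?_⟩ f
  · obtain ⟨i, rfl⟩ := (List.mem_ofFn' _ _).1 hφ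
    exact cutoff_mem_polySumOn 0 i (χ i) hv
  · exact polyIn_sup_zeroOn_le _ _ k (cutoff_mem_polyIn_sup_zeroOn 0 k _ (χ k) (Or.inl h))

theorem cutoffs_sub_mem_polySumOn {α : Fin n → ℕ} (χ : Fin n → SmoothFun)
    {x : Fin n → ℝ} {ε : ℝ} (h : ∀ k s, |s - x k| < ε → (χ k).1 s = 1) (f : CFun n) :
    cutoffs α χ f - f ∈ polySumOn α (Metric.ball x ε) := by
  refine list_prod_sub_mem _ _ (fun φ hφ v => ?_) f
  obtain ⟨k, rfl⟩ := (List.mem_ofFn' _ _).1 hφ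
  exact polyIn_sup_zeroOn_le _ _ k (cutoff_sub_mem_polyIn_sup_zeroOn 0 k _ (χ k) v (h k))

/-- A smooth function that is `1` on the interval of radius `ε / 2` and `0` outside of the
interval of radius `3 ε / 4`. -/
theorem exists_bump (c : ℝ) {ε : ℝ} (hε : 0 < ε) : ∃ χ : SmoothFun,
    (∀ s, |s - c| < ε / 2 → χ.1 s = 1) ∧ ∀ s, 3 * ε / 4 ≤ |s - c| → χ.1 s = 0 := by
  let b : ContDiffBump c := ⟨ε / 2, 3 * ε / 4, half_pos hε, by linarith⟩
  refine ⟨⟨b, b.contDiff⟩, fun s hs => b.one_of_mem_closedBall ?_,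
    fun s hs => b.zero_of_le_dist hs⟩
  exact hs.le

end Cutoff

/-! ### Local representatives of sections and their gluing -/

section LocalSections

variable {n : ℕ}

/-- The restriction of a continuous function to an open set. -/
def restrictTo (U : Opens (Rn n)) : CFun n →ₗ[ℝ] C(U, ℝ) where
  toFun F := ⟨fun x => F x.1, F.continuous.comp continuous_subtype_val⟩
  map_add' _ _ := rfl
  map_smul' _ _ := rfl

theorem restrictTo_eq_update {U : Opens (Rn n)} {k : Fin n} {x : Fin n → ℝ} {t : ℝ}
    (ht : t ∈ sliceDom U k x) (F : CFun n) :
    slice k (restrictTo U F) x t = F (Function.update x k t) := dif_pos ht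

theorem isOpen_sliceDom (U : Opens (Rn n)) (k : Fin n) (x : Fin n → ℝ) :
    IsOpen (sliceDom U k x) :=
  U.isOpen.preimage (continuous_const.update k continuous_id)

theorem partialDeriv_antideriv (U : Opens (Rn n)) (c : Fin n → ℝ) (k : Fin n) (F : CFun n) :
    partialDeriv k (restrictTo U (antideriv c k F)) = restrictTo U F := by
  funext x
  have hx : x.1 k ∈ sliceDom U k x.1 := by simp [sliceDom]
  have h1 : slice k (restrictTo U (antideriv c k F)) x.1 =ᶠ[nhds (x.1 k)]
      fun t => antideriv c k F (Function.update x.1 k t) := by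
    filter_upwards [(isOpen_sliceDom U k x.1).mem_nhds hx] with t ht
    exact restrictTo_eq_update ht _
  rw [partialDeriv, h1.deriv_eq, (hasDerivAt_antideriv c k F x.1 _).deriv,
    Function.update_eq_self]
  rfl

theorem isC1_antideriv (U : Opens (Rn n)) (c : Fin n → ℝ) (k : Fin n) (F : CFun n) :
    IsC1 k (restrictTo U (antideriv c k F)) where
  contDiffOn_slice x := by
    have h : ContDiff ℝ 1 fun t => antideriv c k F (Function.update x.1 k t) := by
      rw [contDiff_one_iff_deriv]
      refine ⟨fun t => (hasDerivAt_antideriv c k F x.1 t).differentiableAt, ?_⟩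
      have : (deriv fun t => antideriv c k F (Function.update x.1 k t)) =
          fun t => F (Function.update x.1 k t) :=
        funext fun t => (hasDerivAt_antideriv c k F x.1 t).deriv
      rw [this]
      exact continuous_slice F k x.1
    exact h.contDiffOn.congr fun t ht => restrictTo_eq_update ht _
  continuous_partialDeriv := by
    rw [partialDeriv_antideriv]
    exact (restrictTo U F).continuous

variable {H : VectSheaf.{u} n} (j : C0Hom H) (δ : Fin n → (H ⟶ H))

/-- The section `δ^α F` over `U`. -/
def derSec (α : Fin n → ℕ) (U : Opens (Rn n)) : CFun n →ₗ[ℝ] Sec H U :=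
  iterD δ α U ∘ₗ j.app U ∘ₗ restrictTo U

variable {j δ}

theorem secRes_derSec (α : Fin n → ℕ) {U V : Opens (Rn n)} (hVU : V ≤ U) (F : CFun n) :
    secRes H hVU (derSec j δ α U F) = derSec j δ α V F := by
  simp only [derSec, LinearMap.comp_apply]
  rw [secRes_iterD, ← j.naturality]
  rfl

theorem IsSolution.commute_secMap (hs : IsSolution H j δ) (U : Opens (Rn n)) (i k : Fin n) :
    Commute (secMap (δ i) U : Module.End ℝ (Sec H U)) (secMap (δ k) U) := by
  have := congrArg (fun φ : H ⟶ H => secMap φ U) (hs.comm k i)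
  exact this

theorem IsSolution.iterD_add (hs : IsSolution H j δ) (α β : Fin n → ℕ) (U : Opens (Rn n)) :
    iterD δ (α + β) U = iterD δ α U * iterD δ β U :=
  powProd_add (hs.commute_secMap U) α β

theorem iterD_single (δ : Fin n → (H ⟶ H)) (k : Fin n) (U : Opens (Rn n)) :
    iterD δ (Pi.single k 1) U = secMap (δ k) U :=
  powProd_single_one _ k

theorem IsSolution.derSec_antiderivs (hs : IsSolution H j δ) (c : Fin n → ℝ) (α β : Fin n → ℕ)
    (U : Opens (Rn n)) (F : CFun n) :
    derSec j δ (α + β) U (antiderivs c β F) = derSec j δ α U F := by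
  induction β using multiindex_induction with
  | h0 => simp
  | h1 β k ih =>
    rw [← ih, antiderivs_add_single, ← add_assoc]
    simp only [derSec, LinearMap.comp_apply]
    rw [hs.iterD_add (α + β), Module.End.mul_apply, iterD_single,
      hs.compat k U _ (isC1_antideriv U c k _)]
    congr 2
    exact ContinuousMap.ext fun x => congrFun (partialDeriv_antideriv U c k _) x

/-- The open ball as an element of `Opens`. -/
def ballOpens (x : Fin n → ℝ) (ε : ℝ) : Opens (Rn n) := ⟨Metric.ball x ε, Metric.isOpen_ball⟩

theorem exists_ballOpens_le {U : Opens (Rn n)} {x : Fin n → ℝ} (hx : x ∈ U) :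
    ∃ ε > 0, ballOpens x ε ≤ U :=
  Metric.isOpen_iff.1 U.isOpen x hx

theorem mem_ballOpens {x : Fin n → ℝ} {ε : ℝ} (hε : 0 < ε) : x ∈ ballOpens x ε :=
  Metric.mem_ball_self hε

theorem germEq_restrictTo {U : Opens (Rn n)} {x : Fin n → ℝ} (hx : x ∈ U) (F : CFun n) :
    GermEq x F (restrictTo U F) := by
  obtain ⟨ε, hε, h⟩ := exists_ballOpens_le hx
  exact ⟨ε, hε, fun y hy => ⟨h hy, rfl⟩⟩

theorem IsSolution.derSec_eq_zero (hs : IsSolution H j δ) {α : Fin n → ℕ} {x : Fin n → ℝ} {ε : ℝ}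
    (hε : 0 < ε) {F : CFun n} (hF : F ∈ polySumOn α (Metric.ball x ε)) :
    derSec j δ α (ballOpens x ε) F = 0 := by
  refine hs.poly α _ _ (isInterval_of_eq_ball hε rfl)
    (isPolySum_of_local (isInterval_of_eq_ball hε rfl) _ fun y hy => ?_)
  obtain ⟨r, hr, h⟩ := exists_ballOpens_le hy
  exact ⟨F, r, hr, fun z hz _ => rfl, polySumOn_mono le_rfl h hF⟩

/-- The section `w` is equal to `δ^α F` near `z`. -/
def LocEq (j : C0Hom H) (δ : Fin n → (H ⟶ H)) {U : Opens (Rn n)} (w : Sec H U) (z : Fin n → ℝ)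
    (α : Fin n → ℕ) (F : CFun n) : Prop :=
  ∃ V : Opens (Rn n), z ∈ V ∧ ∃ hV : V ≤ U, secRes H hV w = derSec j δ α V F

theorem LocEq.of_le {U V : Opens (Rn n)} (hVU : V ≤ U) {w : Sec H U} {z : Fin n → ℝ}
    {α : Fin n → ℕ} {F : CFun n} (h : LocEq j δ (secRes H hVU w) z α F) : LocEq j δ w z α F := by
  obtain ⟨W, hz, hW, h⟩ := h
  exact ⟨W, hz, hW.trans hVU, by rw [← h, secRes_secRes]⟩

theorem LocEq.secRes {U V : Opens (Rn n)} (hVU : V ≤ U) {w : Sec H U} {z : Fin n → ℝ}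
    (hz : z ∈ V) {α : Fin n → ℕ} {F : CFun n} (h : LocEq j δ w z α F) :
    LocEq j δ (secRes H hVU w) z α F := by
  obtain ⟨W, hzW, hW, h⟩ := h
  refine ⟨W ⊓ V, ⟨hzW, hz⟩, inf_le_right, ?_⟩
  rw [secRes_secRes, ← secRes_derSec α (inf_le_left : W ⊓ V ≤ W), ← h, secRes_secRes]

theorem LocEq.add {U : Opens (Rn n)} {w w' : Sec H U} {z : Fin n → ℝ} {α : Fin n → ℕ}
    {F F' : CFun n} (h : LocEq j δ w z α F) (h' : LocEq j δ w' z α F') :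
    LocEq j δ (w + w') z α (F + F') := by
  obtain ⟨V, hz, hV, h⟩ := h
  obtain ⟨V', hz', hV', h'⟩ := h'
  refine ⟨V ⊓ V', ⟨hz, hz'⟩, inf_le_left.trans hV, ?_⟩
  rw [map_add, map_add, ← secRes_derSec α (inf_le_left : V ⊓ V' ≤ V),
    ← secRes_derSec α (inf_le_right : V ⊓ V' ≤ V'), ← h, ← h', secRes_secRes, secRes_secRes]

theorem LocEq.smul {U : Opens (Rn n)} {w : Sec H U} {z : Fin n → ℝ} {α : Fin n → ℕ}
    {F : CFun n} (r : ℝ) (h : LocEq j δ w z α F) : LocEq j δ (r • w) z α (r • F) := by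
  obtain ⟨V, hz, hV, h⟩ := h
  exact ⟨V, hz, hV, by rw [map_smul, map_smul, h]⟩

theorem LocEq.raise (hs : IsSolution H j δ) {U : Opens (Rn n)} {w : Sec H U} {z : Fin n → ℝ}
    {α : Fin n → ℕ} {F : CFun n} (h : LocEq j δ w z α F) (β : Fin n → ℕ) :
    LocEq j δ w z (α + β) (antiderivs 0 β F) := by
  obtain ⟨V, hz, hV, h⟩ := h
  exact ⟨V, hz, hV, by rw [hs.derSec_antiderivs, h]⟩

/-- Together with `LocEq.sub_mem`: representatives of a fixed order are determined near `z` exactly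
up to sums of polynomials. This direction is the polynomial axiom; the converse needs
co-universality. -/
theorem LocEq.of_sub_mem (hs : IsSolution H j δ) {U : Opens (Rn n)} {w : Sec H U} {z : Fin n → ℝ}
    {α : Fin n → ℕ} {F G : CFun n} (h : LocEq j δ w z α F) {ε : ℝ} (hε : 0 < ε)
    (hFG : G - F ∈ polySumOn α (Metric.ball z ε)) : LocEq j δ w z α G := by
  obtain ⟨V, hz, hV, h⟩ := h
  obtain ⟨r, hr, hrV⟩ := exists_ballOpens_le hz
  have hm : 0 < min r ε := lt_min hr hε
  have hle : ballOpens z (min r ε) ≤ V :=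
    le_trans (Metric.ball_subset_ball (min_le_left _ _)) hrV
  refine ⟨ballOpens z (min r ε), mem_ballOpens hm, hle.trans hV, ?_⟩
  have h0 := hs.derSec_eq_zero hm
    (polySumOn_mono le_rfl (Metric.ball_subset_ball (min_le_right r ε)) hFG)
  rw [map_sub, sub_eq_zero] at h0
  rw [h0, ← secRes_derSec α hle, ← h, secRes_secRes]

theorem LocEq.sub_mem (hco : IsCoUniversalSolution H j δ) {U : Opens (Rn n)} {w : Sec H U}
    {z : Fin n → ℝ} {α : Fin n → ℕ} {F G : CFun n} (hF : LocEq j δ w z α F)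
    (hG : LocEq j δ w z α G) : ∃ ε > 0, F - G ∈ polySumOn α (Metric.ball z ε) := by
  obtain ⟨V, hz, hV, hF⟩ := hF
  obtain ⟨V', hz', hV', hG⟩ := hG
  obtain ⟨r, hr, hrV⟩ := exists_ballOpens_le (U := V ⊓ V') ⟨hz, hz'⟩
  have h1 : derSec j δ α (ballOpens z r) (F - G) = 0 := by
    rw [map_sub, sub_eq_zero, ← secRes_derSec α (hrV.trans inf_le_left),
      ← secRes_derSec α (hrV.trans inf_le_right), ← hF, ← hG, secRes_secRes, secRes_secRes]
  have h2 : IsPolySum α (restrictTo (ballOpens z r) (F - G)) :=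
    hco.isPolySum (isInterval_of_eq_ball hr rfl) h1
  exact h2.mem_polySumOn (germEq_restrictTo (mem_ballOpens hr) _)

theorem IsCoUniversalSolution.exists_locEq_finset (hco : IsCoUniversalSolution H j δ)
    {U : Opens (Rn n)} (w : Sec H U) (α : Fin n → ℕ) (s : Finset (Fin n → ℝ))
    (ε : (Fin n → ℝ) → ℝ) (F : (Fin n → ℝ) → CFun n) (hε : ∀ x ∈ s, 0 < ε x)
    (h : ∀ x ∈ s, ∀ z ∈ Metric.ball x (ε x), LocEq j δ w z α (F x)) :
    ∃ G : CFun n, ∀ x ∈ s, ∀ z ∈ Metric.ball x (ε x / 2), LocEq j δ w z α G := by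
  classical
  induction s using Finset.induction_on with
  | empty => exact ⟨0, by simp⟩
  | insert x s _ ih =>
    obtain ⟨G, hG⟩ := ih (fun y hy => hε y (Finset.mem_insert_of_mem hy))
      (fun y hy => h y (Finset.mem_insert_of_mem hy))
    have hx := Finset.mem_insert_self x s
    have hεx := hε x hx
    choose χ h1 h0 using fun k => exists_bump (x k) hεx
    -- Modulo sums of polynomials near `z`, this is `F x` where all cutoffs are `1` and `G` where
    -- one of them is `0`. In between, both `F x` and `G` represent `w`, so their difference, and
    -- hence its cutoff, is already a sum of polynomials.
    refine ⟨G + cutoffs α χ (F x - G), fun y hy z hz => ?_⟩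
    by_cases hzx : z ∈ Metric.ball x (ε x / 2)
    · have hFz := h x hx z (Metric.ball_subset_ball (half_le_self hεx.le) hzx)
      obtain ⟨r, hr, hrx⟩ := Metric.isOpen_iff.1 Metric.isOpen_ball z hzx
      refine hFz.of_sub_mem hco.1 hr ?_
      have := cutoffs_sub_mem_polySumOn (α := α) χ (x := z) (ε := r) (fun k s hs => h1 k s ?_)
        (F x - G)
      · convert this using 1
        abel
      · have hs0 : (0 : ℝ) < ε x / 2 := half_pos hεx
        have := abs_apply_sub_lt (hrx (update_mem_ball (Metric.mem_ball_self hr) hs)) k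
        simpa using this
    · rcases Finset.mem_insert.1 hy with rfl | hys
      · exact absurd hz hzx
      have hGz := hG y hys z hz
      suffices ∃ r > 0, cutoffs α χ (F x - G) ∈ polySumOn α (Metric.ball z r) by
        obtain ⟨r, hr, hm⟩ := this
        exact hGz.of_sub_mem hco.1 hr (by simpa using hm)
      by_cases hzx' : z ∈ Metric.ball x (ε x)
      · obtain ⟨r, hr, hm⟩ := LocEq.sub_mem hco (h x hx z hzx') hGz
        exact ⟨r, hr, cutoffs_mem_polySumOn χ hm⟩
      · rw [Metric.mem_ball, dist_pi_lt_iff hεx] at hzx'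
        push Not at hzx'
        obtain ⟨k, hk⟩ := hzx'
        -- Some coordinate of `z` is at least `ε x` away from that of `x`, while `χ k` vanishes from
        -- distance `3 * ε x / 4` on; the gap is `ε x / 4`.
        refine ⟨ε x / 4, by linarith, cutoffs_mem_polySumOn_of_eq_zero χ (k := k)
          (fun s hs => h0 k s ?_) _⟩
        rw [Real.dist_eq] at hk
        have := abs_sub_le (z k) s (x k)
        rw [abs_sub_comm (z k) s] at this
        linarith

/-- A section that is locally a derivative of a continuous function is one near every compact
set. -/
theorem IsCoUniversalSolution.exists_locEq_of_isCompact (hco : IsCoUniversalSolution H j δ)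
    {U : Opens (Rn n)} (w : Sec H U) (hw : ∀ z ∈ U, ∃ α F, LocEq j δ w z α F)
    {K : Set (Fin n → ℝ)} (hK : IsCompact K) (hKU : K ⊆ (U : Set (Fin n → ℝ))) :
    ∃ (α : Fin n → ℕ) (G : CFun n), ∀ z ∈ K, LocEq j δ w z α G := by
  choose! α F V hzV hV hF using hw
  choose! ε hε hεV using fun x (hx : x ∈ U) => exists_ballOpens_le (hzV x hx)
  obtain ⟨s, hsK, hs⟩ := hK.elim_nhds_subcover (fun x => Metric.ball x (ε x / 2))
    fun x hx => Metric.ball_mem_nhds x (half_pos (hε x (hKU hx)))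
  have hle : ∀ x ∈ s, α x ≤ s.sup α := fun x hx => Finset.le_sup hx
  -- Antiderivatives bring the finitely many representatives to the common order `s.sup α`, as
  -- gluing requires.
  obtain ⟨G, hG⟩ := hco.exists_locEq_finset w (s.sup α) s ε
    (fun x => antiderivs 0 (s.sup α - α x) (F x)) (fun x hx => hε x (hKU (hsK x hx)))
    (fun x hx z hz => by
      have hxU := hKU (hsK x hx)
      have h1 : LocEq j δ w z (α x) (F x) := ⟨V x, hεV x hxU hz, hV x hxU, hF x hxU⟩
      have h2 := h1.raise hco.1 (s.sup α - α x)
      rwa [add_tsub_cancel_of_le (hle x hx)] at h2)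
  refine ⟨s.sup α, G, fun z hz => ?_⟩
  obtain ⟨x, hx, hzx⟩ := Set.mem_iUnion₂.1 (hs hz)
  exact hG x hx z hzx

end LocalSections

/-! ### Subsheaves defined by a local condition -/

section Subsheaf

variable {n : ℕ} (H : VectSheaf.{u} n) (P : ∀ U : Opens (Rn n), Submodule ℝ (Sec H U))
  (hP : ∀ (U V : Opens (Rn n)) (hVU : V ≤ U), ∀ w ∈ P U, secRes H hVU w ∈ P V)

/-- The presheaf of the sections that belong to `P`. -/
def subPresheaf : TopCat.Presheaf (ModuleCat.{u} ℝ) (Rn n) where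
  obj U := ModuleCat.of ℝ (P U.unop)
  map {U V} i := ModuleCat.ofHom ((secRes H i.unop.le).restrict (hP U.unop V.unop i.unop.le))
  map_id _ := ModuleCat.hom_ext (LinearMap.ext fun w => Subtype.ext (secRes_self H le_rfl w.1))
  map_comp i i' := ModuleCat.hom_ext (LinearMap.ext fun w =>
    Subtype.ext (secRes_secRes H i.unop.le i'.unop.le w.1).symm)

theorem subPresheaf_isSheaf
    (hloc : ∀ (U : Opens (Rn n)) (w : Sec H U), (∀ x ∈ U, ∃ V : Opens (Rn n), x ∈ V ∧
      ∃ hV : V ≤ U, secRes H hV w ∈ P V) → w ∈ P U) : (subPresheaf H P hP).IsSheaf := by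
  rw [TopCat.Presheaf.isSheaf_iff_isSheafUniqueGluing]
  intro ι U sf hsf
  obtain ⟨s, hs, hs'⟩ := TopCat.Sheaf.existsUnique_gluing H U (fun i => (sf i).1)
    fun i k => congrArg Subtype.val (hsf i k)
  have hs0 : ∀ i, secRes H (le_iSup U i) s = (sf i).1 := hs
  have hsP : s ∈ P (iSup U) := by
    refine hloc _ s fun x hx => ?_
    obtain ⟨i, hi⟩ := Opens.mem_iSup.1 hx
    exact ⟨U i, hi, le_iSup U i, by rw [hs0 i]; exact (sf i).2⟩
  refine ⟨⟨s, hsP⟩, fun i => Subtype.ext (hs0 i), fun t ht => Subtype.ext ?_⟩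
  exact hs' t.1 fun i => congrArg Subtype.val (ht i)

end Subsheaf

/-! ### The subsheaf of local derivatives and the local structure -/

section Local

variable {n : ℕ} {H : VectSheaf.{u} n} {j : C0Hom H} {δ : Fin n → (H ⟶ H)}

/-- The sections that are locally derivatives of continuous functions. -/
def locSections (hs : IsSolution H j δ) (U : Opens (Rn n)) : Submodule ℝ (Sec H U) where
  carrier := {w | ∀ z ∈ U, ∃ α F, LocEq j δ w z α F}
  add_mem' := by
    intro w w' hw hw' z hz
    obtain ⟨α, F, h⟩ := hw z hz
    obtain ⟨β, G, h'⟩ := hw' z hz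
    have h1 := h'.raise hs α
    rw [add_comm] at h1
    exact ⟨α + β, _, (h.raise hs β).add h1⟩
  zero_mem' z hz := ⟨0, 0, U, hz, le_rfl, by rw [map_zero, map_zero]⟩
  smul_mem' := by
    intro r w hw z hz
    obtain ⟨α, F, h⟩ := hw z hz
    exact ⟨α, _, h.smul r⟩

theorem secRes_mem_locSections (hs : IsSolution H j δ) (U V : Opens (Rn n)) (hVU : V ≤ U) :
    ∀ w ∈ locSections hs U, secRes H hVU w ∈ locSections hs V := by
  intro w hw z hz
  obtain ⟨α, F, h⟩ := hw z (hVU hz)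
  exact ⟨α, F, h.secRes hVU hz⟩

theorem app_mem_locSections (hs : IsSolution H j δ) (U : Opens (Rn n)) (f : C(U, ℝ)) :
    j.app U f ∈ locSections hs U := by
  intro z hz
  obtain ⟨F, ε, hε, hF⟩ := exists_germEq f hz
  have hle : ballOpens z ε ≤ U := fun y hy => (hF y hy).1
  refine ⟨0, F, ballOpens z ε, mem_ballOpens hε, hle, ?_⟩
  rw [← j.naturality]
  simp only [derSec, LinearMap.comp_apply, iterD_eq_powProd, powProd_zero, Module.End.one_apply]
  congr 1
  exact ContinuousMap.ext fun y => (hF y.1 y.2).2.symm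

theorem secMap_mem_locSections (hs : IsSolution H j δ) (k : Fin n) (U : Opens (Rn n)) :
    ∀ w ∈ locSections hs U, secMap (δ k) U w ∈ locSections hs U := by
  intro w hw z hz
  obtain ⟨α, F, V, hzV, hV, h⟩ := hw z hz
  refine ⟨Pi.single k 1 + α, F, V, hzV, hV, ?_⟩
  rw [← secMap_secRes, h]
  simp only [derSec, LinearMap.comp_apply]
  rw [hs.iterD_add, Module.End.mul_apply, iterD_single]

/-- The sheaf of the sections that are locally derivatives of continuous functions. -/
def locSheaf (hs : IsSolution H j δ) : VectSheaf.{u} n :=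
  ⟨subPresheaf H (locSections hs) (secRes_mem_locSections hs),
    subPresheaf_isSheaf H _ _ fun U w h z hz => by
      obtain ⟨V, hzV, hV, h⟩ := h z hz
      obtain ⟨α, F, h⟩ := h z hzV
      exact ⟨α, F, h.of_le hV⟩⟩

/-- The inclusion of `locSheaf`. -/
def locIncl (hs : IsSolution H j δ) : locSheaf hs ⟶ H :=
  ObjectProperty.homMk
    { app := fun U => ModuleCat.ofHom (locSections hs U.unop).subtype }

/-- The embedding of the continuous functions into `locSheaf`. -/
def locJ (hs : IsSolution H j δ) : C0Hom (locSheaf hs) where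
  app U := (j.app U).codRestrict (locSections hs U) (app_mem_locSections hs U)
  naturality U V hVU f := Subtype.ext (j.naturality U V hVU f)

/-- The derivatives on `locSheaf`. -/
def locD (hs : IsSolution H j δ) (k : Fin n) : locSheaf hs ⟶ locSheaf hs :=
  ObjectProperty.homMk
    { app := fun U => ModuleCat.ofHom
        ((secMap (δ k) U.unop).restrict (secMap_mem_locSections hs k U.unop))
      naturality := fun _ _ i => ModuleCat.hom_ext (LinearMap.ext fun w =>
        Subtype.ext (secMap_secRes (δ k) i.unop.le w.1)) }

theorem locIncl_injective (hs : IsSolution H j δ) (U : Opens (Rn n)) :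
    Function.Injective (secMap (locIncl hs) U) := Subtype.val_injective

theorem locD_incl (hs : IsSolution H j δ) (k : Fin n) :
    locD hs k ≫ locIncl hs = locIncl hs ≫ δ k := rfl

theorem locSheaf_isSolution (hs : IsSolution H j δ) :
    IsSolution (locSheaf hs) (locJ hs) (locD hs) where
  compat k U f hf := locIncl_injective hs U (hs.compat k U f hf)
  poly α U f hU hf := by
    apply locIncl_injective hs U
    rw [secMap_iterD (locD_incl hs), map_zero]
    exact hs.poly α U f hU hf
  comm h k := by
    apply ObjectProperty.hom_ext
    refine NatTrans.ext (funext fun U => ModuleCat.hom_ext (LinearMap.ext fun w => ?_))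
    refine Subtype.ext ?_
    exact LinearMap.congr_fun (hs.commute_secMap U.unop k h).eq w.1

/-- Every section of a co-universal solution is locally a derivative of a continuous function. -/
theorem IsCoUniversalSolution.exists_locEq (hco : IsCoUniversalSolution H j δ)
    {U : Opens (Rn n)} (w : Sec H U) : ∀ z ∈ U, ∃ α F, LocEq j δ w z α F := by
  obtain ⟨ψ, hψ, -⟩ := hco.2 _ _ _ (locSheaf_isSolution hco.1)
  have h1 : Preserves j δ j δ (ψ ≫ locIncl hco.1) :=
    { embed := fun U f => by
        change secMap (locIncl hco.1) U (secMap ψ U (j.app U f)) = j.app U f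
        rw [hψ.embed]
        rfl
      deriv := fun k => by
        rw [← Category.assoc, hψ.deriv, Category.assoc, locD_incl, Category.assoc] }
  have h2 : Preserves j δ j δ (𝟙 H) :=
    { embed := fun U f => rfl
      deriv := fun k => by rw [Category.comp_id, Category.id_comp] }
  -- Uniqueness is applied with `H` itself as the target solution. The inclusion thus has a right
  -- inverse, so every section of `H` comes from the subsheaf.
  have h3 : ψ ≫ locIncl hco.1 = 𝟙 H := (hco.2 _ _ _ hco.1).unique h1 h2
  have h4 : secMap (locIncl hco.1) U (secMap ψ U w) = w :=
    congrArg (fun φ : H ⟶ H => secMap φ U w) h3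
  have h5 : secMap (locIncl hco.1) U (secMap ψ U w) ∈ locSections hco.1 U :=
    Subtype.property (p := fun w => w ∈ locSections hco.1 U) (secMap ψ U w)
  rw [h4] at h5
  exact h5

theorem IsCoUniversalSolution.exists_secRes_eq (hco : IsCoUniversalSolution H j δ)
    {U C : Opens (Rn n)} (hCU : C ≤ U) (hC : IsCompact (closure (C : Set (Fin n → ℝ))))
    (hCU' : closure (C : Set (Fin n → ℝ)) ⊆ (U : Set (Fin n → ℝ))) (w : Sec H U) :
    ∃ (α : Fin n → ℕ) (f : C(C, ℝ)), secRes H hCU w = iterD δ α C (j.app C f) := by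
  obtain ⟨α, G, hG⟩ := hco.exists_locEq_of_isCompact w (hco.exists_locEq w) hC hCU'
  -- `G` represents `w` near each point of `closure C` with the same `α`, so separation of the sheaf
  -- gives equality on all of `C`.
  refine ⟨α, restrictTo C G, eq_of_locally_eq H fun z hz => ?_⟩
  obtain ⟨V, hzV, hV, h⟩ := (hG z (subset_closure hz)).secRes hCU hz
  exact ⟨V, hV, hzV, h.trans (secRes_derSec α hV G).symm⟩

end Local

end DistrUP

theorem mainTheorem6 (n : ℕ) (H : DistrUP.VectSheaf.{u} n) (j : DistrUP.C0Hom H)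
    (δ : Fin n → (H ⟶ H)) (hco : DistrUP.IsCoUniversalSolution H j δ) :
    (∀ (U C : Opens (DistrUP.Rn n)) (hCU : C ≤ U),
        IsCompact (closure (C : Set (Fin n → ℝ))) →
        closure (C : Set (Fin n → ℝ)) ⊆ (U : Set (Fin n → ℝ)) →
        ∀ w : DistrUP.Sec H U, ∃ (α : Fin n → ℕ) (f : C(C, ℝ)),
          DistrUP.secRes H hCU w = DistrUP.iterD δ α C (j.app C f)) ∧
    (∀ (α : Fin n → ℕ) (U : Opens (DistrUP.Rn n)) (f g : C(U, ℝ)), DistrUP.IsInterval U →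
        DistrUP.iterD δ α U (j.app U f) = DistrUP.iterD δ α U (j.app U g) →
        DistrUP.IsPolySum α (f - g)) := by
  refine ⟨fun U C hCU hC hCU' w => hco.exists_secRes_eq hCU hC hCU' w,
    fun α U f g hU h => hco.isPolySum hU ?_⟩
  rw [map_sub, map_sub, h, sub_self]
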